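/- For a bounded simply connected open set $\Omega\subset\mathbb{C}$ let $H^2(\Omega)$ be the Hilbert space of holomorphic functions on $\Omega$ that are square-integrable for Lebesgue measure $m$, and let $B_\Omega(z,w)$ be its Bergman (reproducing) kernel, so that $f(z)=\int_\Omega B_\Omega(z,w)f(w)\,dm(w)$ for all $f\in H^2(\Omega)$, $z\in\Omega$, with $B_\Omega(\cdot,w)\in H^2(\Omega)$ and $B_\Omega(z,w)=\overline{B_\Omega(w,z)}$. Then: 1. For every $c>0$ there is a constant $M(c)>0$ such that for every bounded simply connected open set $\Omega\subset\mathbb{C}$, every $0<\epsilon\le 1$ and all $z,w\in\Omega$ with $\mathrm{dist}(z,\partial\Omega)\ge c\epsilon$ and $\mathrm{dist}(w,\partial\Omega)\ge c\epsilon$, we have $$|B_\Omega(z,w)|\le M(c)\,\epsilon^{-2}.$$ 2. For every $c>0$ there is a constant $\widetilde M(c)>0$ such that for every $0<\alpha<1$, every bounded simply connected open set $\Omega\subset\mathbb{C}$, every $0<\epsilon\le 1$ and all $z,w\in\Omega$ with $$c\epsilon\le\mathrm{dist}(z,\partial\Omega)\le\epsilon,\qquad c\epsilon\le\mathrm{dist}(w,\partial\Omega)\le\epsilon,\qquad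 |z-w|\ge c\,\epsilon^{\alpha},$$ we have $$|B_\Omega(z,w)|\le \widetilde M(c)\,\epsilon^{-1-\alpha}.$$ In particular the constants $M(c),\widetilde M(c)$ do not depend on $\Omega$. -/

import Mathlib

section BergmanDefs

open MeasureTheory Metric
open scoped Real

theorem enorm_le_lintegral_circle {g : ℂ → ℂ} {z : ℂ} {r ρ : ℝ} (hρ : 0 < ρ) (hρr : ρ < r)
    (hg : DifferentiableOn ℂ g (closedBall z r)) :
    ENNReal.ofReal (2 * π) * ‖g z‖ₑ ≤ ∫⁻ θ in Set.Ioo (-π) π, ‖g (circleMap z ρ θ)‖ₑ := by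
  have h1 : Real.circleAverage g z ρ = g z := by
    apply DiffContOnCl.circleAverage
    rw [abs_of_pos hρ]
    exact (hg.mono (closedBall_subset_closedBall hρr.le)).diffContOnCl_ball subset_rfl
  have h2 : (2 * π) • g z = ∫ θ in (-π)..π, g (circleMap z ρ θ) := by
    rw [← h1, Real.circleAverage_def, smul_smul, mul_inv_cancel₀ (by positivity), one_smul]
    have := (periodic_circleMap z ρ).comp g
    have h := this.intervalIntegral_add_eq 0 (-π)
    simp only [zero_add, Function.comp_def] at h
    rw [h]; congr 1; ring
  have h3 : ENNReal.ofReal (2 * π) * ‖g z‖ₑ = ‖(2 * π) • g z‖ₑ := by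
    rw [enorm_smul, Real.enorm_of_nonneg (by positivity)]
  rw [h3, h2, intervalIntegral.integral_of_le (by linarith [Real.pi_pos]), integral_Ioc_eq_integral_Ioo]
  exact enorm_integral_le_lintegral_enorm _

/-- The area form of the sub-mean-value inequality for holomorphic functions. -/
theorem area_mean_value_le {g : ℂ → ℂ} {z : ℂ} {r : ℝ} (hr : 0 < r)
    (hg : DifferentiableOn ℂ g (closedBall z r)) :
    ENNReal.ofReal (π * r ^ 2) * ‖g z‖ₑ ≤ ∫⁻ w in ball z r, ‖g w‖ₑ := by
  set S : Set (ℝ × ℝ) := Set.Ioo 0 r ×ˢ Set.Ioo (-π) π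
  have hS : MeasurableSet S := measurableSet_Ioo.prod measurableSet_Ioo
  have h1 : ∫⁻ w in ball z r, ‖g w‖ₑ =
      ∫⁻ w, (ball z r).indicator (fun w => ‖g w‖ₑ) (z + w) := by
    rw [lintegral_add_left_eq_self, lintegral_indicator measurableSet_ball]
  rw [h1, ← Complex.lintegral_comp_polarCoord_symm]
  have hpol : ∀ p : ℝ × ℝ, z + Complex.polarCoord.symm p = circleMap z p.1 p.2 := by
    intro p
    rw [Complex.polarCoord_symm_apply, circleMap, Complex.exp_mul_I]
    push_cast
    ring
  have hmem : ∀ p ∈ S, circleMap z p.1 p.2 ∈ ball z r := by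
    rintro p ⟨⟨hp0, hpr⟩, -⟩
    rw [mem_ball, dist_eq_norm]
    simpa [circleMap, abs_of_pos hp0] using hpr
  have hcont : ContinuousOn (fun p : ℝ × ℝ => g (circleMap z p.1 p.2)) S := by
    refine hg.continuousOn.comp ?_ fun p hp => ball_subset_closedBall (hmem p hp)
    unfold circleMap
    fun_prop
  have hmeas : AEMeasurable (fun p : ℝ × ℝ => ENNReal.ofReal p.1 * ‖g (circleMap z p.1 p.2)‖ₑ)
      ((volume.restrict (Set.Ioo 0 r)).prod (volume.restrict (Set.Ioo (-π) π))) := by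
    rw [Measure.prod_restrict]
    exact (measurable_fst.ennreal_ofReal.aemeasurable).mul (hcont.aemeasurable hS).enorm
  calc ENNReal.ofReal (π * r ^ 2) * ‖g z‖ₑ
      = ∫⁻ ρ in Set.Ioo 0 r, ENNReal.ofReal ρ * (ENNReal.ofReal (2 * π) * ‖g z‖ₑ) := by
        rw [lintegral_mul_const' _ _ (by finiteness)]
        have : ∫⁻ ρ in Set.Ioo 0 r, ENNReal.ofReal ρ = ENNReal.ofReal (r ^ 2 / 2) := by
          rw [← ofReal_integral_eq_lintegral_ofReal]
          · rw [← integral_Ioc_eq_integral_Ioo, ← intervalIntegral.integral_of_le hr.le]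
            simp
          · exact (continuous_id.integrableOn_Icc (a := 0) (b := r)).mono_set Set.Ioo_subset_Icc_self
          · filter_upwards [ae_restrict_mem measurableSet_Ioo] with x hx using hx.1.le
        rw [this, ← mul_assoc, ← ENNReal.ofReal_mul (by positivity)]
        congr 2
        ring
    _ ≤ ∫⁻ ρ in Set.Ioo 0 r, ∫⁻ θ in Set.Ioo (-π) π,
          ENNReal.ofReal ρ * ‖g (circleMap z ρ θ)‖ₑ := by
        refine setLIntegral_mono' measurableSet_Ioo fun ρ hρ => ?_
        rw [lintegral_const_mul' _ _ (by finiteness)]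
        gcongr
        exact enorm_le_lintegral_circle hρ.1 hρ.2 hg
    _ = ∫⁻ p in S, ENNReal.ofReal p.1 * ‖g (circleMap z p.1 p.2)‖ₑ := by
        rw [← lintegral_prod _ hmeas, Measure.prod_restrict]
        rfl
    _ = ∫⁻ p in S, ENNReal.ofReal p.1 *
          (ball z r).indicator (fun w => ‖g w‖ₑ) (z + Complex.polarCoord.symm p) := by
        refine setLIntegral_congr_fun hS fun p hp => ?_
        simp only [hpol, Set.indicator_of_mem (hmem p hp)]
    _ ≤ _ := lintegral_mono_set (Set.prod_mono (fun x hx => hx.1) subset_rfl)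

theorem norm_le_of_holomorphic_Lp {Ω : Set ℂ} {f : ℂ → ℂ} (hf : DifferentiableOn ℂ f Ω)
    {F : Lp ℂ 2 (volume.restrict Ω)} (hF : F =ᵐ[volume.restrict Ω] f) {z : ℂ} {r : ℝ}
    (hr : 0 < r) (hz : closedBall z r ⊆ Ω) :
    ‖f z‖ ≤ (√π * r)⁻¹ * ‖F‖ := by
  have h1 := area_mean_value_le (g := fun w => f w ^ 2) hr ((hf.mono hz).pow 2)
  have h2 : ∫⁻ w in ball z r, ‖f w ^ 2‖ₑ ≤ ‖F‖ₑ ^ 2 := by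
    calc ∫⁻ w in ball z r, ‖f w ^ 2‖ₑ ≤ ∫⁻ w in Ω, ‖f w ^ 2‖ₑ :=
          lintegral_mono_set (ball_subset_closedBall.trans hz)
      _ = ∫⁻ w in Ω, ‖F w‖ₑ ^ 2 := by
          refine lintegral_congr_ae ?_
          filter_upwards [hF] with w hw
          simp [hw]
      _ = ‖F‖ₑ ^ 2 := by
          rw [Lp.enorm_def]
          have := eLpNorm_nnreal_pow_eq_lintegral (f := (F : ℂ → ℂ)) (μ := volume.restrict Ω)
            (p := 2) (by norm_num)
          simpa using this.symm
  have h3 := h1.trans h2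
  rw [← ofReal_norm, ← ofReal_norm, ← ENNReal.ofReal_mul (by positivity),
    ← ENNReal.ofReal_pow (by positivity), ENNReal.ofReal_le_ofReal_iff (by positivity)] at h3
  rw [← div_eq_inv_mul, le_div_iff₀ (by positivity)]
  refine le_of_sq_le_sq ?_ (norm_nonneg _)
  rw [mul_pow, mul_pow, Real.sq_sqrt (by positivity)]
  rw [norm_pow] at h3
  linarith

theorem holomorphic_rep_unique {Ω : Set ℂ} (hΩ : IsOpen Ω) {f g : ℂ → ℂ}
    (hf : DifferentiableOn ℂ f Ω) (hg : DifferentiableOn ℂ g Ω)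
    (h : f =ᵐ[volume.restrict Ω] g) : Set.EqOn f g Ω :=
  Measure.eqOn_open_of_ae_eq h hΩ hf.continuousOn hg.continuousOn

/-- The Bergman space `H²(Ω)` of an open set `Ω ⊆ ℂ`: the square-integrable holomorphic functions on
`Ω`, as a subspace of `L²(Ω)` for Lebesgue measure. -/
def bergmanSpace (Ω : TopologicalSpace.Opens ℂ) :
    Submodule ℂ (Lp ℂ 2 (volume.restrict (Ω : Set ℂ))) where
  carrier := {F | ∃ f : ℂ → ℂ, DifferentiableOn ℂ f Ω ∧ F =ᵐ[volume.restrict (Ω : Set ℂ)] f}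
  add_mem' := by
    rintro F G ⟨f, hf, hFf⟩ ⟨g, hg, hGg⟩
    exact ⟨f + g, hf.add hg, (Lp.coeFn_add F G).trans (hFf.add hGg)⟩
  zero_mem' := ⟨0, differentiableOn_const 0, Lp.coeFn_zero _ _ _⟩
  smul_mem' := by
    rintro c F ⟨f, hf, hFf⟩
    exact ⟨c • f, hf.const_smul c, (Lp.coeFn_smul c F).trans (hFf.const_smul c)⟩

namespace bergmanSpace

variable {Ω : TopologicalSpace.Opens ℂ}

/-- The holomorphic function on `Ω` (unique on `Ω`, arbitrary outside) representing an element of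
the Bergman space. -/
noncomputable def rep (F : bergmanSpace Ω) : ℂ → ℂ := F.2.choose

theorem differentiableOn_rep (F : bergmanSpace Ω) : DifferentiableOn ℂ (rep F) Ω :=
  F.2.choose_spec.1

theorem ae_eq_rep (F : bergmanSpace Ω) :
    (F : Lp ℂ 2 (volume.restrict (Ω : Set ℂ))) =ᵐ[volume.restrict (Ω : Set ℂ)] rep F :=
  F.2.choose_spec.2

theorem eqOn_rep (F : bergmanSpace Ω) {f : ℂ → ℂ} (hf : DifferentiableOn ℂ f Ω)
    (h : (F : Lp ℂ 2 (volume.restrict (Ω : Set ℂ))) =ᵐ[volume.restrict (Ω : Set ℂ)] f) :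
    Set.EqOn (rep F) f Ω :=
  holomorphic_rep_unique Ω.isOpen (differentiableOn_rep F) hf ((ae_eq_rep F).symm.trans h)

theorem isClosed (Ω : TopologicalSpace.Opens ℂ) :
    IsClosed (bergmanSpace Ω : Set (Lp ℂ 2 (volume.restrict (Ω : Set ℂ)))) := by
  refine IsSeqClosed.isClosed fun F G hF hG => ?_
  choose f hf hFf using hF
  have hb : ∀ z : ℂ, ∀ r > 0, closedBall z r ⊆ Ω → ∀ n m,
      ‖f n z - f m z‖ ≤ (√π * r)⁻¹ * ‖F n - F m‖ := fun z r hr hz n m =>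
    norm_le_of_holomorphic_Lp (f := f n - f m) ((hf n).sub (hf m))
      ((Lp.coeFn_sub _ _).trans ((hFf n).sub (hFf m))) hr hz
  have hlim : ∀ z ∈ Ω, ∃ l, Filter.Tendsto (fun n => f n z) Filter.atTop (nhds l) := by
    intro z hz
    obtain ⟨r, hr, hzr⟩ := nhds_basis_closedBall.mem_iff.1 (Ω.isOpen.mem_nhds hz)
    refine cauchySeq_tendsto_of_complete ?_
    have hC := hG.cauchySeq
    rw [Metric.cauchySeq_iff] at hC ⊢
    intro ε hε
    obtain ⟨N, hN⟩ := hC (ε * (√π * r)) (by positivity)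
    refine ⟨N, fun m hm n hn => ?_⟩
    have := hN m hm n hn
    rw [dist_eq_norm] at this ⊢
    refine (hb z r hr hzr m n).trans_lt ?_
    rw [← div_eq_inv_mul, div_lt_iff₀ (by positivity)]
    exact this
  choose! g hg using hlim
  have hu : TendstoLocallyUniformlyOn f g Filter.atTop Ω := by
    rw [Metric.tendstoLocallyUniformlyOn_iff]
    intro ε hε z hz
    obtain ⟨r, hr, hzr⟩ := nhds_basis_closedBall.mem_iff.1 (Ω.isOpen.mem_nhds hz)
    refine ⟨closedBall z (r / 2),
      mem_nhdsWithin_of_mem_nhds (closedBall_mem_nhds z (by positivity)), ?_⟩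
    have hC := (tendsto_iff_norm_sub_tendsto_zero.1 hG).const_mul (√π * (r / 2))⁻¹
    rw [mul_zero] at hC
    filter_upwards [hC.eventually (gt_mem_nhds hε)] with n hn y hy
    have hyr : closedBall y (r / 2) ⊆ Ω := by
      refine (closedBall_subset_closedBall' ?_).trans hzr
      rw [mem_closedBall] at hy
      linarith
    rw [dist_comm, dist_eq_norm]
    refine lt_of_le_of_lt ?_ hn
    refine le_of_tendsto_of_tendsto (tendsto_const_nhds.sub (hg y (hyr (mem_closedBall_self (by positivity))))).norm
      ((tendsto_const_nhds.sub hG).norm.const_mul _) (.of_forall fun m => hb y _ (by positivity) hyr n m)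
  refine ⟨g, hu.differentiableOn (.of_forall hf) Ω.isOpen, ?_⟩
  obtain ⟨ns, hns, hae⟩ := (tendstoInMeasure_of_tendsto_Lp hG).exists_seq_tendsto_ae
  filter_upwards [hae, ae_all_iff.2 hFf, ae_restrict_mem Ω.isOpen.measurableSet] with z h1 h2 h3
  refine tendsto_nhds_unique h1 ?_
  simp only [h2]
  exact (hg z h3).comp hns.tendsto_atTop

instance : CompleteSpace (bergmanSpace Ω) := (isClosed Ω).completeSpace_coe

/-- Evaluation `f ↦ f z` at a point `z ∈ Ω`, as a bounded linear functional on the Bergman space. -/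
noncomputable def evalCLM (z : Ω) : bergmanSpace Ω →L[ℂ] ℂ := by
  refine LinearMap.mkContinuousOfExistsBound
    { toFun := fun F => rep F z
      map_add' := fun F G => ?_
      map_smul' := fun c F => ?_ } ?_
  · exact eqOn_rep (F + G) ((differentiableOn_rep F).add (differentiableOn_rep G))
      ((Lp.coeFn_add _ _).trans ((ae_eq_rep F).add (ae_eq_rep G))) z.2
  · exact eqOn_rep (c • F) ((differentiableOn_rep F).const_smul c)
      ((Lp.coeFn_smul _ _).trans ((ae_eq_rep F).const_smul c)) z.2
  · obtain ⟨r, hr, hzr⟩ := nhds_basis_closedBall.mem_iff.1 (Ω.isOpen.mem_nhds z.2)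
    exact ⟨(√π * r)⁻¹, fun F =>
      norm_le_of_holomorphic_Lp (differentiableOn_rep F) (ae_eq_rep F) hr hzr⟩

/-- The Bergman space is a reproducing kernel Hilbert space of functions `Ω → ℂ`: an element is sent
to its holomorphic representative on `Ω`. -/
noncomputable instance : RKHS ℂ (bergmanSpace Ω) Ω ℂ where
  coeCLM := ContinuousLinearMap.pi evalCLM
  coeCLM_injective := by
    intro F G h
    refine Subtype.ext (Lp.ext ?_)
    filter_upwards [ae_eq_rep F, ae_eq_rep G, ae_restrict_mem Ω.isOpen.measurableSet]
      with z h1 h2 h3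
    rw [h1, h2]
    exact congrFun h ⟨z, h3⟩

end bergmanSpace

/-- The Bergman kernel `B_Ω(z, w)`: the reproducing kernel of the Bergman space, that is
`f z = ∫_Ω B_Ω(z, w) f w dm(w)` for all `f ∈ H²(Ω)`, where `B_Ω(·, w) ∈ H²(Ω)` and
`B_Ω(z, w)` is the complex conjugate of `B_Ω(w, z)`. -/
noncomputable def bergmanKernel (Ω : TopologicalSpace.Opens ℂ) (z w : Ω) : ℂ :=
  RKHS.kernel (bergmanSpace Ω) z w 1

end BergmanDefs

/-!
# Uniform bounds for the Bergman kernel of a simply connected domain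

The first bound is the area mean value property: evaluation at a point whose distance to the
boundary exceeds `r` has norm at most `(√π * r)⁻¹` on the Bergman space (`norm_bergmanKernel_le`).

For the second bound let `F` be the Riemann map of `Ω` onto the unit disc with `F w = 0`. The area
mean value property on the disc, pulled back by `F`, gives
`B_Ω(z, w) = F' z * conj (F' w) / π` (`bergmanKernel_eq_of_riemann_map`). By the Schwarz–Pick
inequality `‖F' w‖ ≤ 1 / dist(w, ∂Ω)` and `‖F' z‖ ≤ (1 - ‖F z‖ ^ 2) / dist(z, ∂Ω)`, so everything
rests on the estimate `1 - ‖F z‖ ≲ ε / ‖z - w‖` (`one_sub_norm_mul_le`), which says that `z` and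
`w` are far apart in the hyperbolic metric.

That estimate needs the sharp constant in the Koebe quarter theorem: if `f = F⁻¹` omits `a`, then
`‖f' u‖ * (1 - ‖u‖ ^ 2) ≤ 4 * ‖f u - a‖`, so that along a radius `log ‖f - a‖` varies at most twice
as fast as `log ((1 + x) / (1 - x))`. On the radius from `0` to `F z` there is a point whose image
`p` is equidistant from `z` and `w`. Let `a` and `b` be the boundary points closest to `z` and `w`.
Comparing `p` with `w` on one part of the radius and with `z` on the rest yields
`‖p - b‖ * ‖p - a‖ ≤ ε ^ 2 * ((1 + R) / (1 - R)) ^ 2` with `R = ‖F z‖`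
(`norm_sub_mul_norm_sub_le`), while the left side is at least of order `‖z - w‖ ^ 2` once
`‖z - w‖ ≥ 4 * ε`. Using both ends of the radius is what produces the exponent `-1 - α`.

The Riemann mapping theorem for bounded domains is proved by Koebe's extremal argument
(`exists_riemann_map`). The quarter theorem (`norm_deriv_zero_le_of_injOn_ne_zero`) follows, by
taking a square root, from the bound `‖h' 0‖ ≤ 1` for injective `h` with `h 0 = 0` and
`h x * h y ≠ 1` (`norm_deriv_le_one_of_mul_ne_one`). The latter compares areas for the density
`‖w‖⁻²`, which is invariant under `w ↦ w⁻¹`.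
-/

open Metric Set Filter MeasureTheory
open scoped Topology Real ComplexConjugate

/-! ### Limits of holomorphic functions -/

/-- **Hurwitz's theorem**: a locally uniform limit of nowhere vanishing holomorphic functions on a
domain vanishes nowhere or identically. -/
theorem hurwitz_ne_zero {ι : Type*} {φ : Filter ι} [φ.NeBot] {U : Set ℂ} (hU : IsOpen U)
    (hUc : IsPreconnected U) {F : ι → ℂ → ℂ} {g : ℂ → ℂ} (hF : ∀ i, DifferentiableOn ℂ (F i) U)
    (hF0 : ∀ i, ∀ z ∈ U, F i z ≠ 0) (hlim : TendstoLocallyUniformlyOn F g φ U)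
    (hg : ∃ z ∈ U, g z ≠ 0) {z : ℂ} (hz : z ∈ U) : g z ≠ 0 := by
  intro hgz
  have hgd : DifferentiableOn ℂ g U := hlim.differentiableOn (.of_forall hF) hU
  have hga : AnalyticOnNhd ℂ g U := hgd.analyticOnNhd hU
  rcases (hga z hz).eventually_eq_zero_or_eventually_ne_zero with h | h
  · obtain ⟨y, hy, hgy⟩ := hg
    exact hgy (hga.eqOn_zero_of_preconnected_of_eventuallyEq_zero hUc hz h hy)
  · rw [eventually_nhdsWithin_iff] at h
    obtain ⟨r, hr, hball⟩ := nhds_basis_closedBall.mem_iff.1 (h.and (hU.mem_nhds hz))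
    have hsub : closedBall z r ⊆ U := fun y hy => (hball hy).2
    have hne : ∀ y ∈ sphere z r, g y ≠ 0 := fun y hy =>
      (hball (sphere_subset_closedBall hy)).1 (ne_of_mem_sphere hy hr.ne')
    obtain ⟨y₀, hy₀, hmin⟩ := (isCompact_sphere z r).exists_isMinOn
      (NormedSpace.sphere_nonempty.2 hr.le)
      (hgd.continuousOn.mono (sphere_subset_closedBall.trans hsub)).norm
    set m := ‖g y₀‖
    have hm : 0 < m := norm_pos_iff.2 (hne y₀ hy₀)
    have hunif := (tendstoLocallyUniformlyOn_iff_forall_isCompact hU).1 hlim _ hsub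
      (isCompact_closedBall z r)
    obtain ⟨i, hi⟩ := (Metric.tendstoUniformlyOn_iff.1 hunif (m / 2) (by positivity)).exists
    have hi0 := hi z (mem_closedBall_self hr.le)
    rw [hgz, dist_zero_left] at hi0
    -- the maximum principle for `1 / F i` bounds `F i z` from below by its values on the circle
    have hd : DiffContOnCl ℂ (fun y => (F i y)⁻¹) (ball z r) :=
      (((hF i).mono hsub).inv fun y hy => hF0 i y (hsub hy)).diffContOnCl_ball subset_rfl
    have hmax : ‖(F i z)⁻¹‖ ≤ (m / 2)⁻¹ := by
      refine Complex.norm_le_of_forall_mem_frontier_norm_le isBounded_ball hd (fun y hy => ?_)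
        (subset_closure (mem_ball_self hr))
      rw [frontier_ball z hr.ne'] at hy
      rw [norm_inv]
      refine inv_anti₀ (by positivity) ?_
      have h1 : m ≤ ‖g y‖ := hmin hy
      have h2 := hi y (sphere_subset_closedBall hy)
      rw [dist_eq_norm] at h2
      have h3 := norm_sub_norm_le (g y) (F i y)
      linarith
    rw [norm_inv] at hmax
    have := (inv_le_inv₀ (norm_pos_iff.2 (hF0 i z hz)) (by positivity)).1 hmax
    linarith

/-- A locally uniform limit of injective holomorphic functions on a domain is injective or
constant. -/
theorem hurwitz_injOn {ι : Type*} {φ : Filter ι} [φ.NeBot] {U : Set ℂ} (hU : IsOpen U)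
    (hUc : IsPreconnected U) {F : ι → ℂ → ℂ} {g : ℂ → ℂ} (hF : ∀ i, DifferentiableOn ℂ (F i) U)
    (hinj : ∀ i, InjOn (F i) U) (hlim : TendstoLocallyUniformlyOn F g φ U)
    (hg : ∀ c, ∃ z ∈ U, g z ≠ c) : InjOn g U := by
  intro a ha b hb hab
  by_contra hne
  have hga : AnalyticOnNhd ℂ g U :=
    (hlim.differentiableOn (.of_forall hF) hU).analyticOnNhd hU
  obtain ⟨r, hr, hball⟩ := Metric.mem_nhds_iff.1
    (inter_mem (hU.mem_nhds hb) (isOpen_compl_singleton.mem_nhds (Ne.symm hne) : {a}ᶜ ∈ 𝓝 b))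
  have hsub : ball b r ⊆ U := fun y hy => (hball hy).1
  have hpt : Tendsto (fun i => F i a) φ (𝓝 (g a)) := hlim.tendsto_at ha
  have hconst : TendstoUniformlyOn (fun i (_ : ℂ) => F i a) (fun _ => g a) φ (ball b r) := by
    rw [Metric.tendstoUniformlyOn_iff]
    intro ε hε
    filter_upwards [Metric.tendsto_nhds.1 hpt ε hε] with i hi y _
    rwa [dist_comm]
  have hlim' : TendstoLocallyUniformlyOn (fun i y => F i y - F i a) (fun y => g y - g a) φ
      (ball b r) := (hlim.mono hsub).sub hconst.tendstoLocallyUniformlyOn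
  by_cases hz : ∃ y ∈ ball b r, g y - g a ≠ 0
  · refine hurwitz_ne_zero isOpen_ball isPreconnected_ball
      (fun i => ((hF i).mono hsub).sub_const _) (fun i y hy => ?_) hlim' hz (mem_ball_self hr)
      (by simp [hab])
    exact sub_ne_zero.2 fun h => (hball hy).2 (hinj i (hsub hy) ha h)
  · push Not at hz
    obtain ⟨y, hy, hgy⟩ := hg (g a)
    refine hgy (hga.eqOn_of_preconnected_of_eventuallyEq analyticOnNhd_const hUc hb ?_ hy)
    filter_upwards [ball_mem_nhds b hr] with x hx
    exact sub_eq_zero.1 (hz x hx)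

/-- **Montel's theorem**: a family of holomorphic functions bounded by `1` converges locally
uniformly along every ultrafilter on its index set, which takes the place of a subsequence. -/
theorem montel_ultrafilter {ι : Type*} (φ : Ultrafilter ι) {U : Set ℂ} (hU : IsOpen U)
    {F : ι → ℂ → ℂ} (hF : ∀ i, DifferentiableOn ℂ (F i) U) (hb : ∀ i, ∀ z ∈ U, ‖F i z‖ ≤ 1) :
    ∃ g : ℂ → ℂ, TendstoLocallyUniformlyOn F g φ U := by
  have hpt : ∀ z ∈ U, ∃ l, Tendsto (fun i => F i z) φ (𝓝 l) := by
    intro z hz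
    obtain ⟨l, -, hl⟩ := (isCompact_closedBall (0 : ℂ) 1).ultrafilter_le_nhds
      (φ.map fun i => F i z) (by
        rw [le_principal_iff, Ultrafilter.mem_coe, Ultrafilter.mem_map]
        exact univ_mem' fun i => by simpa using hb i z hz)
    exact ⟨l, hl⟩
  choose! g hg using hpt
  refine ⟨g, (tendstoLocallyUniformlyOn_iff_forall_isCompact hU).2 fun K hKU hK => ?_⟩
  -- the Schwarz lemma makes the family equicontinuous
  have heq : EquicontinuousOn F K := by
    intro z hz
    obtain ⟨r, hr, hball⟩ := Metric.isOpen_iff.1 hU z (hKU hz)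
    refine EquicontinuousAt.equicontinuousWithinAt ?_ K
    rw [Metric.equicontinuousAt_iff]
    intro ε hε
    refine ⟨min r (ε * r / 3), by positivity, fun y hy i => ?_⟩
    have hy1 : y ∈ ball z r := (lt_min_iff.1 hy).1
    have hmaps : MapsTo (F i) (ball z r) (ball (F i z) 3) := by
      intro x hx
      rw [mem_ball, dist_eq_norm]
      have := norm_sub_le (F i x) (F i z)
      linarith [hb i x (hball hx), hb i z (hKU hz)]
    have h1 := Complex.dist_le_div_mul_dist_of_mapsTo_ball ((hF i).mono hball)
      (hmaps.mono_right ball_subset_closedBall) hy1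
    rw [dist_comm]
    refine h1.trans_lt ?_
    have hy2 : dist y z < ε * r / 3 := (lt_min_iff.1 hy).2
    rw [div_mul_eq_mul_div, div_lt_iff₀ hr]
    linarith
  have h2 := (EquicontinuousOn.tendsto_uniformOnFun_iff_pi' (𝔖 := {K}) (F := F)
    (by simpa using hK) (by simpa using heq) φ g).2 (by
      rw [tendsto_pi_nhds]
      intro x
      exact hg x (hKU (by simpa using x.2)))
  exact (UniformOnFun.tendsto_iff_tendstoUniformlyOn.1 h2) K rfl

/-! ### Holomorphic square roots -/

theorem exists_differentiableOn_sqrt {U : Set ℂ} (hU : IsOpen U) (hUc : IsSimplyConnected U)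
    {g : ℂ → ℂ} (hg : DifferentiableOn ℂ g U) (hg0 : ∀ z ∈ U, g z ≠ 0) :
    ∃ s : ℂ → ℂ, DifferentiableOn ℂ s U ∧ ∀ z, s z ^ 2 = g z := by
  obtain ⟨s, hsc, hs⟩ := Complex.exists_continuousOn_pow_eq hUc hU hg.continuousOn
    (by rintro ⟨z, hz, h⟩; exact hg0 z hz h) two_ne_zero
  refine ⟨s, fun z hz => ?_, hs⟩
  have hsz : s z ≠ 0 := fun h => hg0 z hz (by rw [← hs, h]; simp)
  have hcont : ContinuousAt s z := hsc.continuousAt (hU.mem_nhds hz)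
  have hsum : s z + s z ≠ 0 := by simpa [← two_mul] using hsz
  have hd := (hg.differentiableAt (hU.mem_nhds hz)).hasDerivAt
  rw [hasDerivAt_iff_tendsto_slope] at hd
  have hadd : ContinuousAt (fun y => s y + s z) z := hcont.add continuousAt_const
  refine (HasDerivAt.differentiableAt (f' := deriv g z / (s z + s z)) ?_).differentiableWithinAt
  rw [hasDerivAt_iff_tendsto_slope]
  refine (hd.div (hadd.tendsto.mono_left nhdsWithin_le_nhds) hsum).congr' ?_
  filter_upwards [nhdsWithin_le_nhds (hadd.eventually_ne hsum)] with y hy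
  rw [Pi.div_apply, slope_def_field, slope_def_field, ← hs, ← hs, div_div, mul_comm (y - z),
    ← div_div]
  congr 1
  field_simp
  ring

/-! ### Automorphisms of the unit disc -/

/-- The automorphism of the unit disc that sends `a` to `0`, for `‖a‖ < 1`. -/
noncomputable def discShift (a z : ℂ) : ℂ := (z - a) / (1 - conj a * z)

theorem one_sub_conj_mul_ne_zero {a z : ℂ} (ha : ‖a‖ < 1) (hz : ‖z‖ < 1) :
    1 - conj a * z ≠ 0 := by
  intro h
  have h1 : ‖conj a * z‖ = 1 := by rw [← sub_eq_zero.1 h, norm_one]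
  rw [norm_mul, Complex.norm_conj] at h1
  nlinarith [norm_nonneg a, norm_nonneg z]

@[simp] theorem discShift_self (a : ℂ) : discShift a a = 0 := by simp [discShift]

theorem discShift_zero (a : ℂ) : discShift a 0 = -a := by simp [discShift]

theorem hasDerivAt_discShift {a z : ℂ} (ha : ‖a‖ < 1) (hz : ‖z‖ < 1) :
    HasDerivAt (discShift a) ((1 - (‖a‖ : ℂ) ^ 2) / (1 - conj a * z) ^ 2) z := by
  have h0 := one_sub_conj_mul_ne_zero ha hz
  have h := ((hasDerivAt_id z).sub_const a).fun_div
    (((hasDerivAt_id z).const_mul (conj a)).const_sub 1) h0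
  refine h.congr_deriv ?_
  rw [← Complex.conj_mul']
  congr 1
  simp only [id]
  ring

theorem norm_discShift_lt_one {a z : ℂ} (ha : ‖a‖ < 1) (hz : ‖z‖ < 1) : ‖discShift a z‖ < 1 := by
  have h0 := one_sub_conj_mul_ne_zero ha hz
  rw [discShift, norm_div, div_lt_one (norm_pos_iff.2 h0), ← sq_lt_sq₀ (norm_nonneg _)
    (norm_nonneg _)]
  rw [Complex.sq_norm, Complex.sq_norm]
  have ha' : Complex.normSq a < 1 := by
    rw [← Complex.sq_norm]; nlinarith [norm_nonneg a]
  have hz' : Complex.normSq z < 1 := by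
    rw [← Complex.sq_norm]; nlinarith [norm_nonneg z]
  simp only [Complex.normSq_apply, Complex.sub_re, Complex.sub_im, Complex.one_re, Complex.one_im,
    Complex.mul_re, Complex.mul_im, Complex.conj_re, Complex.conj_im] at *
  nlinarith [mul_pos (sub_pos.2 ha') (sub_pos.2 hz')]

theorem mapsTo_discShift {a : ℂ} (ha : ‖a‖ < 1) : MapsTo (discShift a) (ball 0 1) (ball 0 1) :=
  fun z hz => by
    rw [mem_ball_zero_iff] at *
    exact norm_discShift_lt_one ha hz

theorem differentiableOn_discShift {a : ℂ} (ha : ‖a‖ < 1) :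
    DifferentiableOn ℂ (discShift a) (ball 0 1) := fun _ hz =>
  (hasDerivAt_discShift ha (mem_ball_zero_iff.1 hz)).differentiableAt.differentiableWithinAt

theorem injOn_discShift {a : ℂ} (ha : ‖a‖ < 1) : InjOn (discShift a) (ball 0 1) := by
  intro x hx y hy h
  rw [mem_ball_zero_iff] at hx hy
  rw [discShift, discShift, div_eq_div_iff (one_sub_conj_mul_ne_zero ha hx)
    (one_sub_conj_mul_ne_zero ha hy)] at h
  have h1 : (x - y) * (1 - conj a * a) = 0 := by linear_combination h
  exact sub_eq_zero.1 ((mul_eq_zero.1 h1).resolve_right (one_sub_conj_mul_ne_zero ha ha))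

/-! ### The Riemann mapping theorem -/

/-- The competitors in the extremal problem whose solution is the Riemann map of `U`: injective
holomorphic maps from `U` to the unit disc that send `z₀` to `0`. Injectivity forces the derivative
not to vanish; requiring this explicitly costs nothing, since Hurwitz's theorem applies to
derivatives as well, and makes the inverse map differentiable. -/
structure IsDiscEmbedding (U : Set ℂ) (z₀ : ℂ) (F : ℂ → ℂ) : Prop where
  differentiableOn : DifferentiableOn ℂ F U
  mapsTo : MapsTo F U (ball 0 1)
  injOn : InjOn F U
  deriv_ne_zero : ∀ z ∈ U, deriv F z ≠ 0
  map_base : F z₀ = 0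

theorem exists_isDiscEmbedding {U : Set ℂ} (hb : Bornology.IsBounded U) (z₀ : ℂ) :
    ∃ F, IsDiscEmbedding U z₀ F := by
  obtain ⟨R, hR⟩ := hb.subset_ball z₀
  set R' := max R 1
  have hR' : 0 < R' := by positivity
  have hd : ∀ z, HasDerivAt (fun z : ℂ => (z - z₀) / R') (1 / R') z := fun z =>
    ((hasDerivAt_id z).sub_const z₀).div_const _
  have hne : (R' : ℂ) ≠ 0 := by exact_mod_cast hR'.ne'
  refine ⟨fun z => (z - z₀) / R', fun z _ => (hd z).differentiableAt.differentiableWithinAt,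
    fun z hz => ?_, fun x _ y _ h => ?_, fun z _ => ?_, by simp⟩
  · have := hR hz
    rw [mem_ball, dist_eq_norm] at this
    rw [mem_ball_zero_iff, norm_div, Complex.norm_real, Real.norm_of_nonneg hR'.le,
      div_lt_one hR']
    exact this.trans_le (le_max_left _ _)
  · simpa [hne] using h
  · rw [(hd z).deriv]
    exact one_div_ne_zero hne

/-- Koebe's square root trick: a competitor that omits a point of the disc can be replaced by one
with larger derivative at the base point. -/
theorem IsDiscEmbedding.exists_larger {U : Set ℂ} (hU : IsOpen U) (hUc : IsSimplyConnected U)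
    {z₀ : ℂ} (hz₀ : z₀ ∈ U) {F : ℂ → ℂ} (hF : IsDiscEmbedding U z₀ F) {b : ℂ} (hb : ‖b‖ < 1)
    (hbF : b ∉ F '' U) : ∃ G, IsDiscEmbedding U z₀ G ∧ ‖deriv F z₀‖ < ‖deriv G z₀‖ := by
  have hF1 : ∀ z ∈ U, ‖F z‖ < 1 := fun z hz => mem_ball_zero_iff.1 (hF.mapsTo hz)
  have hFd : ∀ z ∈ U, HasDerivAt F (deriv F z) z := fun z hz =>
    (hF.differentiableOn.differentiableAt (hU.mem_nhds hz)).hasDerivAt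
  have hb0 : b ≠ 0 := fun h => hbF ⟨z₀, hz₀, by rw [hF.map_base, h]⟩
  have hgd : ∀ z ∈ U, HasDerivAt (fun z => discShift b (F z))
      ((1 - (‖b‖ : ℂ) ^ 2) / (1 - conj b * F z) ^ 2 * deriv F z) z := fun z hz =>
    (hasDerivAt_discShift hb (hF1 z hz)).comp z (hFd z hz)
  have hg0 : ∀ z ∈ U, discShift b (F z) ≠ 0 := by
    intro z hz h
    rw [← discShift_self b] at h
    exact hbF ⟨z, hz, injOn_discShift hb (hF.mapsTo hz) (mem_ball_zero_iff.2 hb) h⟩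
  obtain ⟨s, hsd, hs⟩ := exists_differentiableOn_sqrt hU hUc
    (fun z hz => (hgd z hz).differentiableAt.differentiableWithinAt) hg0
  have hs1 : ∀ z ∈ U, ‖s z‖ < 1 := by
    intro z hz
    have h := norm_discShift_lt_one hb (hF1 z hz)
    rw [← hs, norm_pow] at h
    exact (pow_lt_one_iff_of_nonneg (norm_nonneg _) two_ne_zero).1 h
  have hsd' : ∀ z ∈ U, HasDerivAt s (deriv s z) z := fun z hz =>
    (hsd.differentiableAt (hU.mem_nhds hz)).hasDerivAt
  have hseq : ∀ z ∈ U, 2 * s z * deriv s z =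
      (1 - (‖b‖ : ℂ) ^ 2) / (1 - conj b * F z) ^ 2 * deriv F z := by
    intro z hz
    have h1 := (hsd' z hz).fun_pow 2
    simp only [hs] at h1
    have := h1.unique (hgd z hz)
    simpa using this
  have hbb : (1 - (‖b‖ : ℂ) ^ 2) ≠ 0 := by
    norm_cast
    nlinarith [norm_nonneg b]
  have hs0 : ∀ z ∈ U, deriv s z ≠ 0 := by
    intro z hz h
    have h1 := hseq z hz
    rw [h, mul_zero] at h1
    exact mul_ne_zero (div_ne_zero hbb (pow_ne_zero 2 (one_sub_conj_mul_ne_zero hb (hF1 z hz))))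
      (hF.deriv_ne_zero z hz) h1.symm
  set a := s z₀ with ha
  have ha1 : ‖a‖ < 1 := hs1 z₀ hz₀
  have hGd : ∀ z ∈ U, HasDerivAt (fun z => discShift a (s z))
      ((1 - (‖a‖ : ℂ) ^ 2) / (1 - conj a * s z) ^ 2 * deriv s z) z := fun z hz =>
    (hasDerivAt_discShift ha1 (hs1 z hz)).comp z (hsd' z hz)
  have haa : (1 - (‖a‖ : ℂ) ^ 2) ≠ 0 := by
    norm_cast
    nlinarith [norm_nonneg a]
  refine ⟨fun z => discShift a (s z),
    ⟨fun z hz => (hGd z hz).differentiableAt.differentiableWithinAt,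
    fun z hz => mapsTo_discShift ha1 (mem_ball_zero_iff.2 (hs1 z hz)), fun x hx y hy h => ?_,
    fun z hz => ?_, discShift_self a⟩, ?_⟩
  · have h1 := injOn_discShift ha1 (mem_ball_zero_iff.2 (hs1 x hx))
      (mem_ball_zero_iff.2 (hs1 y hy)) h
    have h2 : discShift b (F x) = discShift b (F y) := by rw [← hs, ← hs, h1]
    exact hF.injOn hx hy (injOn_discShift hb (hF.mapsTo hx) (hF.mapsTo hy) h2)
  · rw [(hGd z hz).deriv]
    exact mul_ne_zero (div_ne_zero haa (pow_ne_zero 2 (one_sub_conj_mul_ne_zero ha1 (hs1 z hz))))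
      (hs0 z hz)
  · -- the derivative grows by the factor `(1 + t ^ 2) / (2 * t)`, where `t = ‖a‖ = √‖b‖ < 1`
    have hab : a ^ 2 = -b := by rw [ha, hs, hF.map_base, discShift_zero]
    have hnab : ‖b‖ = ‖a‖ ^ 2 := by rw [← norm_pow, hab, norm_neg]
    have hapos : 0 < ‖a‖ := norm_pos_iff.2 fun h => hb0 (by
      rw [h] at hab; simpa using hab.symm)
    have h1 := congrArg norm (hseq z₀ hz₀)
    have hnb : ‖(1 - (‖b‖ : ℂ) ^ 2)‖ = 1 - ‖b‖ ^ 2 := by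
      norm_cast
      rw [Real.norm_of_nonneg]
      nlinarith [norm_nonneg b]
    rw [hF.map_base, mul_zero, sub_zero, one_pow, div_one, norm_mul, norm_mul, norm_mul, hnb,
      hnab, ← ha, Complex.norm_ofNat] at h1
    have hpos : 0 < 1 - ‖a‖ ^ 2 := by nlinarith
    have h2 : ‖deriv (fun z => discShift a (s z)) z₀‖ = ‖deriv s z₀‖ / (1 - ‖a‖ ^ 2) := by
      rw [(hGd z₀ hz₀).deriv, ← ha, Complex.conj_mul']
      have : (1 - (‖a‖ : ℂ) ^ 2) / (1 - (‖a‖ : ℂ) ^ 2) ^ 2 * deriv s z₀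
          = deriv s z₀ / ((1 - ‖a‖ ^ 2 : ℝ) : ℂ) := by
        push_cast
        field_simp
      rw [this, norm_div, Complex.norm_real, Real.norm_of_nonneg hpos.le]
    have hsp : 0 < ‖deriv s z₀‖ := norm_pos_iff.2 (hs0 z₀ hz₀)
    rw [h2, lt_div_iff₀ hpos]
    have hsq : (1 - (‖a‖ ^ 2) ^ 2) = (1 - ‖a‖ ^ 2) * (1 + ‖a‖ ^ 2) := by ring
    rw [hsq] at h1
    have hlt : 2 * ‖a‖ < 1 + ‖a‖ ^ 2 := by nlinarith [sq_pos_of_pos (sub_pos.2 ha1)]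
    have hFp : 0 < ‖deriv F z₀‖ := norm_pos_iff.2 (hF.deriv_ne_zero z₀ hz₀)
    have h3 := mul_lt_mul_of_pos_right hlt (mul_pos hpos hFp)
    have h4 : 2 * ‖a‖ * ((1 - ‖a‖ ^ 2) * ‖deriv F z₀‖) < 2 * ‖a‖ * ‖deriv s z₀‖ := by
      rw [h1]; nlinarith
    have h5 := lt_of_mul_lt_mul_left h4 (by positivity)
    linarith

/-- The extremal problem has a solution: normal families provide a limit of a maximizing sequence,
and Hurwitz's theorem shows that the limit is again a competitor. -/
theorem exists_isDiscEmbedding_maximal {U : Set ℂ} (hU : IsOpen U) (hUc : IsPreconnected U)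
    (hb : Bornology.IsBounded U) {z₀ : ℂ} (hz₀ : z₀ ∈ U) :
    ∃ F, IsDiscEmbedding U z₀ F ∧ ∀ G, IsDiscEmbedding U z₀ G → ‖deriv G z₀‖ ≤ ‖deriv F z₀‖ := by
  set S : Set ℝ := {t | ∃ F, IsDiscEmbedding U z₀ F ∧ ‖deriv F z₀‖ = t} with hS
  obtain ⟨F₀, hF₀⟩ := exists_isDiscEmbedding hb z₀
  have hne : S.Nonempty := ⟨_, F₀, hF₀, rfl⟩
  obtain ⟨r, hr, hball⟩ := Metric.isOpen_iff.1 hU z₀ hz₀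
  have hbdd : BddAbove S := by
    refine ⟨1 / r, ?_⟩
    rintro _ ⟨F, hF, rfl⟩
    refine Complex.norm_deriv_le_div_of_mapsTo_ball (hF.differentiableOn.mono hball) ?_ hr
    rw [hF.map_base]
    exact (hF.mapsTo.mono_left hball).mono_right ball_subset_closedBall
  obtain ⟨u, -, hu, huS⟩ := exists_seq_tendsto_sSup hne hbdd
  choose F hF hFu using huS
  obtain ⟨g, hg⟩ := montel_ultrafilter (hyperfilter ℕ) hU (fun n => (hF n).differentiableOn)
    (fun n z hz => (mem_ball_zero_iff.1 ((hF n).mapsTo hz)).le)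
  have hgd : DifferentiableOn ℂ g U :=
    hg.differentiableOn (.of_forall fun n => (hF n).differentiableOn) hU
  have hderiv : TendstoLocallyUniformlyOn (deriv ∘ F) (deriv g) (hyperfilter ℕ : Filter ℕ) U :=
    hg.deriv (.of_forall fun n => (hF n).differentiableOn) hU
  have hsup : ‖deriv g z₀‖ = sSup S := by
    refine tendsto_nhds_unique (hderiv.tendsto_at hz₀).norm ?_
    simp only [Function.comp_def, hFu]
    exact hu.mono_left (Nat.hyperfilter_le_atTop)
  have hmax : ∀ G, IsDiscEmbedding U z₀ G → ‖deriv G z₀‖ ≤ ‖deriv g z₀‖ := fun G hG => by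
    rw [hsup]
    exact le_csSup hbdd ⟨G, hG, rfl⟩
  have hg0 : deriv g z₀ ≠ 0 := norm_pos_iff.1
    ((norm_pos_iff.2 (hF₀.deriv_ne_zero z₀ hz₀)).trans_le (hmax F₀ hF₀))
  have hnc : ∀ c, ∃ z ∈ U, g z ≠ c := by
    intro c
    by_contra! h
    refine hg0 ?_
    have : g =ᶠ[𝓝 z₀] fun _ => c := by
      filter_upwards [hU.mem_nhds hz₀] with z hz using h z hz
    rw [this.deriv_eq, deriv_const]
  have hle : ∀ z ∈ U, ‖g z‖ ≤ 1 := fun z hz =>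
    le_of_tendsto (hg.tendsto_at hz).norm
      (.of_forall fun n => (mem_ball_zero_iff.1 ((hF n).mapsTo hz)).le)
  refine ⟨g, ⟨hgd, fun z hz => ?_, ?_, fun z hz => ?_, ?_⟩, hmax⟩
  · -- by the maximum principle the limit does not touch the unit circle
    rw [mem_ball_zero_iff]
    refine lt_of_le_of_ne (hle z hz) fun h => ?_
    obtain ⟨y, hy, hgy⟩ := hnc (g z)
    refine hgy (Complex.eqOn_of_isPreconnected_of_isMaxOn_norm hUc hU hgd hz (fun y hy => ?_) hy)
    simpa [h] using hle y hy
  · exact hurwitz_injOn hU hUc (fun n => (hF n).differentiableOn) (fun n => (hF n).injOn) hg hnc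
  · exact hurwitz_ne_zero hU hUc (fun n => (hF n).differentiableOn.deriv hU)
      (fun n => (hF n).deriv_ne_zero) hderiv ⟨z₀, hz₀, hg0⟩ hz
  · refine tendsto_nhds_unique (hg.tendsto_at hz₀) ?_
    simp only [(hF _).map_base, tendsto_const_nhds]

/-- The **Riemann mapping theorem** for bounded domains. -/
theorem exists_riemann_map {U : Set ℂ} (hU : IsOpen U) (hUc : IsSimplyConnected U)
    (hb : Bornology.IsBounded U) {z₀ : ℂ} (hz₀ : z₀ ∈ U) :
    ∃ F, IsDiscEmbedding U z₀ F ∧ F '' U = ball 0 1 := by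
  obtain ⟨F, hF, hmax⟩ := exists_isDiscEmbedding_maximal hU
    hUc.isPathConnected.isConnected.isPreconnected hb hz₀
  refine ⟨F, hF, hF.mapsTo.image_subset.antisymm fun b hb => ?_⟩
  by_contra hbF
  obtain ⟨G, hG, hlt⟩ := hF.exists_larger hU hUc hz₀ (mem_ball_zero_iff.1 hb) hbF
  exact (hmax G hG).not_gt hlt

/-! ### Change of variables and polar coordinates -/

theorem det_complex_smul_one (c : ℂ) : (c • (1 : ℂ →L[ℝ] ℂ)).det = ‖c‖ ^ 2 := by
  rw [ContinuousLinearMap.det, ← LinearMap.det_toMatrix Complex.basisOneI, Matrix.det_fin_two]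
  simp [LinearMap.toMatrix_apply, Complex.sq_norm, Complex.normSq_apply]

theorem lintegral_image_holomorphic {U : Set ℂ} (hU : IsOpen U) {f : ℂ → ℂ}
    (hf : DifferentiableOn ℂ f U) (hinj : InjOn f U) (g : ℂ → ENNReal) :
    ∫⁻ w in f '' U, g w = ∫⁻ z in U, ‖deriv f z ^ 2‖ₑ * g (f z) := by
  rw [lintegral_image_eq_lintegral_abs_det_fderiv_mul volume hU.measurableSet (fun z hz =>
    ((hf.differentiableAt (hU.mem_nhds hz)).hasDerivAt.complexToReal_fderiv).hasFDerivWithinAt)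
    hinj]
  refine lintegral_congr fun z => ?_
  rw [det_complex_smul_one, ← ofReal_norm, abs_of_nonneg (by positivity), norm_pow]

/-- The open annulus `a < ‖z‖ < b`. -/
def annulus (a b : ℝ) : Set ℂ := {z | a < ‖z‖ ∧ ‖z‖ < b}

theorem isOpen_annulus (a b : ℝ) : IsOpen (annulus a b) :=
  (isOpen_lt continuous_const continuous_norm).inter (isOpen_lt continuous_norm continuous_const)

theorem polarCoord_symm_eq_circleMap (p : ℝ × ℝ) :
    Complex.polarCoord.symm p = circleMap 0 p.1 p.2 := by
  rw [Complex.polarCoord_symm_apply, circleMap, Complex.exp_mul_I]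
  push_cast
  ring

theorem norm_circleMap_zero_of_pos {r : ℝ} (hr : 0 < r) (θ : ℝ) : ‖circleMap 0 r θ‖ = r := by
  simp [circleMap, abs_of_pos hr]

theorem circleMap_mem_annulus {a b : ℝ} (ha : 0 ≤ a) {p : ℝ × ℝ}
    (hp : p ∈ Ioo a b ×ˢ Ioo (-π) π) : circleMap 0 p.1 p.2 ∈ annulus a b := by
  have h := norm_circleMap_zero_of_pos (ha.trans_lt hp.1.1) p.2
  exact ⟨hp.1.1.trans_eq h.symm, h.trans_lt hp.1.2⟩

theorem continuousOn_comp_circleMap {β : Type*} [TopologicalSpace β] {a b : ℝ} (ha : 0 ≤ a)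
    {G : ℂ → β} (hG : ContinuousOn G (annulus a b)) :
    ContinuousOn (fun p : ℝ × ℝ => G (circleMap 0 p.1 p.2)) (Ioo a b ×ˢ Ioo (-π) π) := by
  refine hG.comp (Continuous.continuousOn ?_) fun p hp => circleMap_mem_annulus ha hp
  unfold circleMap
  fun_prop

/-- In polar coordinates the annulus becomes a rectangle; `m` stands for the Jacobian factor, so
that the statement serves for both the Lebesgue and the Bochner integral. -/
theorem indicator_polarCoord_target {β M : Type*} [Zero β] [SMulZeroClass M β] {a b : ℝ}
    (ha : 0 ≤ a) (G : ℂ → β) (m : ℝ → M) :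
    polarCoord.target.indicator
        (fun p => m p.1 • (annulus a b).indicator G (Complex.polarCoord.symm p)) =
      (Ioo a b ×ˢ Ioo (-π) π).indicator fun p => m p.1 • G (circleMap 0 p.1 p.2) := by
  simp only [polarCoord_symm_eq_circleMap]
  ext p
  by_cases hp : p ∈ Ioo a b ×ˢ Ioo (-π) π
  · have hpt : p ∈ polarCoord.target := ⟨ha.trans_lt hp.1.1, hp.2⟩
    rw [indicator_of_mem hp, indicator_of_mem hpt, indicator_of_mem (circleMap_mem_annulus ha hp)]
  · rw [indicator_of_notMem hp]
    by_cases hpt : p ∈ polarCoord.target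
    · rw [indicator_of_mem hpt, indicator_of_notMem, smul_zero]
      rintro ⟨h1, h2⟩
      rw [norm_circleMap_zero_of_pos hpt.1] at h1 h2
      exact hp ⟨⟨h1, h2⟩, hpt.2⟩
    · rw [indicator_of_notMem hpt]

theorem lintegral_annulus_eq_prod {a b : ℝ} (ha : 0 ≤ a) (G : ℂ → ENNReal) :
    ∫⁻ z in annulus a b, G z =
      ∫⁻ p in Ioo a b ×ˢ Ioo (-π) π, ENNReal.ofReal p.1 * G (circleMap 0 p.1 p.2) := by
  rw [← lintegral_indicator (isOpen_annulus a b).measurableSet,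
    ← Complex.lintegral_comp_polarCoord_symm,
    ← lintegral_indicator polarCoord.open_target.measurableSet,
    indicator_polarCoord_target ha G ENNReal.ofReal,
    lintegral_indicator (measurableSet_Ioo.prod measurableSet_Ioo)]
  simp only [smul_eq_mul]

theorem integral_annulus_eq_prod {a b : ℝ} (ha : 0 ≤ a) (G : ℂ → ℂ) :
    ∫ z in annulus a b, G z =
      ∫ p in Ioo a b ×ˢ Ioo (-π) π, p.1 • G (circleMap 0 p.1 p.2) := by
  rw [← integral_indicator (isOpen_annulus a b).measurableSet,
    ← Complex.integral_comp_polarCoord_symm,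
    ← integral_indicator polarCoord.open_target.measurableSet,
    indicator_polarCoord_target ha G fun r => r,
    integral_indicator (measurableSet_Ioo.prod measurableSet_Ioo)]

theorem lintegral_annulus {a b : ℝ} (ha : 0 ≤ a) {G : ℂ → ENNReal}
    (hG : ContinuousOn G (annulus a b)) :
    ∫⁻ z in annulus a b, G z =
      ∫⁻ r in Ioo a b, ENNReal.ofReal r * ∫⁻ θ in Ioo (-π) π, G (circleMap 0 r θ) := by
  have hmeas : AEMeasurable (fun p : ℝ × ℝ => ENNReal.ofReal p.1 * G (circleMap 0 p.1 p.2))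
      ((volume.restrict (Ioo a b)).prod (volume.restrict (Ioo (-π) π))) := by
    rw [Measure.prod_restrict]
    exact measurable_fst.ennreal_ofReal.aemeasurable.mul
      ((continuousOn_comp_circleMap ha hG).aemeasurable (measurableSet_Ioo.prod measurableSet_Ioo))
  rw [lintegral_annulus_eq_prod ha, Measure.volume_eq_prod, ← Measure.prod_restrict,
    lintegral_prod _ hmeas]
  refine lintegral_congr fun r => ?_
  rw [lintegral_const_mul' _ _ ENNReal.ofReal_ne_top]

theorem lintegral_inv_Ioo {a b : ℝ} (ha : 0 < a) (hab : a ≤ b) :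
    ∫⁻ r in Ioo a b, ENNReal.ofReal r⁻¹ = ENNReal.ofReal (Real.log (b / a)) := by
  rw [← integral_inv_of_pos ha (ha.trans_le hab), intervalIntegral.integral_of_le hab,
    integral_Ioc_eq_integral_Ioo, ofReal_integral_eq_lintegral_ofReal]
  · refine IntegrableOn.mono_set (ContinuousOn.integrableOn_Icc (a := a) (b := b) ?_)
      Ioo_subset_Icc_self
    exact continuousOn_id.inv₀ fun x hx => (ha.trans_le hx.1).ne'
  · filter_upwards [ae_restrict_mem measurableSet_Ioo] with x hx
    exact inv_nonneg.2 (ha.trans hx.1).le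

theorem ofReal_mul_enorm_div_circleMap_sq {r : ℝ} (hr : 0 < r) (g : ℂ → ℂ) :
    ENNReal.ofReal r * ∫⁻ θ in Ioo (-π) π, ‖g (circleMap 0 r θ) / circleMap 0 r θ ^ 2‖ₑ =
      ENNReal.ofReal r⁻¹ * ∫⁻ θ in Ioo (-π) π, ‖g (circleMap 0 r θ)‖ₑ := by
  rw [← lintegral_const_mul' _ _ ENNReal.ofReal_ne_top,
    ← lintegral_const_mul' _ _ ENNReal.ofReal_ne_top]
  refine lintegral_congr fun θ => ?_
  rw [← ofReal_norm, ← ofReal_norm, ← ENNReal.ofReal_mul hr.le,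
    ← ENNReal.ofReal_mul (inv_nonneg.2 hr.le), norm_div, norm_pow,
    norm_circleMap_zero_of_pos hr]
  congr 1
  field_simp

theorem continuousOn_enorm_div_sq {a b : ℝ} (ha : 0 ≤ a) {g : ℂ → ℂ}
    (hg : ContinuousOn g (annulus a b)) :
    ContinuousOn (fun z => ‖g z / z ^ 2‖ₑ) (annulus a b) :=
  (hg.div (continuousOn_id.pow 2) fun _ hz =>
    pow_ne_zero 2 (norm_pos_iff.1 (ha.trans_lt hz.1))).enorm

/-- The area of an annulus with respect to the density `‖z‖⁻²`. -/
theorem logArea_annulus {a b : ℝ} (ha : 0 < a) (hab : a ≤ b) :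
    ∫⁻ z in annulus a b, ‖1 / z ^ 2‖ₑ = ENNReal.ofReal (2 * π * Real.log (b / a)) := by
  rw [lintegral_annulus ha.le (continuousOn_enorm_div_sq (g := fun _ => 1) ha.le
    continuousOn_const)]
  rw [setLIntegral_congr_fun measurableSet_Ioo fun r hr =>
    ofReal_mul_enorm_div_circleMap_sq (ha.trans hr.1) fun _ => 1]
  simp only [enorm_one, lintegral_one, Measure.restrict_apply_univ, Real.volume_Ioo]
  rw [lintegral_mul_const' _ _ ENNReal.ofReal_ne_top, lintegral_inv_Ioo ha hab,
    ← ENNReal.ofReal_mul (Real.log_nonneg ((one_le_div ha).2 hab))]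
  congr 1
  ring

/-- The mean value property on circles, integrated against the density `‖z‖⁻²`. -/
theorem le_lintegral_annulus {a b : ℝ} (ha : 0 < a) (hab : a ≤ b) {g : ℂ → ℂ}
    (hg : DifferentiableOn ℂ g (ball 0 b)) :
    ENNReal.ofReal (2 * π * Real.log (b / a)) * ‖g 0‖ₑ ≤ ∫⁻ z in annulus a b, ‖g z / z ^ 2‖ₑ := by
  rw [lintegral_annulus ha.le (continuousOn_enorm_div_sq ha.le
    (hg.continuousOn.mono fun z hz => mem_ball_zero_iff.2 hz.2))]
  calc _ = ∫⁻ r in Ioo a b, ENNReal.ofReal r⁻¹ * (ENNReal.ofReal (2 * π) * ‖g 0‖ₑ) := by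
        rw [lintegral_mul_const' _ _ (by finiteness), lintegral_inv_Ioo ha hab, ← mul_assoc,
          ← ENNReal.ofReal_mul (Real.log_nonneg ((one_le_div ha).2 hab))]
        congr 2
        ring
    _ ≤ _ := by
        refine setLIntegral_mono' measurableSet_Ioo fun r hr => ?_
        have hr0 := ha.trans hr.1
        rw [ofReal_mul_enorm_div_circleMap_sq hr0]
        gcongr
        refine enorm_le_lintegral_circle (r := (r + b) / 2) hr0 (by linarith [hr.2])
          (hg.mono (closedBall_subset_ball (by linarith [hr.2])))

/-! ### The Koebe quarter theorem -/

/-- If `‖h' 0‖ > 1`, a local inverse of `h` at `0` contracts: points near `0` have preimages closer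
to `0` by a factor `q < 1`. -/
theorem exists_preimage_norm_le {h : ℂ → ℂ} (hd : DifferentiableOn ℂ h (ball 0 1)) (h0 : h 0 = 0)
    (hder : 1 < ‖deriv h 0‖) : ∃ ρ > 0, ρ < 1 ∧ ∃ q > 0, q < 1 ∧ ∀ w, ‖w‖ ≤ ρ →
      ∃ ζ ∈ ball (0 : ℂ) 1, h ζ = w ∧ ‖ζ‖ ≤ q * ‖w‖ := by
  have hne : deriv h 0 ≠ 0 := norm_pos_iff.1 (zero_lt_one.trans hder)
  have hs : HasStrictDerivAt h (deriv h 0) 0 :=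
    ((hd.analyticOnNhd isOpen_ball) 0 (mem_ball_self one_pos)).hasStrictDerivAt
  set k := hs.localInverse h (deriv h 0) 0 hne
  have hk : HasDerivAt k (deriv h 0)⁻¹ 0 := by
    have := (hs.to_localInverse hne).hasDerivAt
    rwa [h0] at this
  have hk0 : k 0 = 0 := by
    have := (hs.hasStrictFDerivAt_equiv hne).localInverse_apply_image
    rwa [h0] at this
  have hright : ∀ᶠ w in 𝓝 0, h (k w) = w := by
    have := (hs.hasStrictFDerivAt_equiv hne).eventually_right_inverse
    rwa [h0] at this
  have hinv : ‖(deriv h 0)⁻¹‖ < 1 := by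
    rw [norm_inv]
    exact inv_lt_one_of_one_lt₀ hder
  obtain ⟨q, hq0, hq1⟩ := exists_between hinv
  have hlip : ∀ᶠ w in 𝓝 0, ‖k w‖ ≤ q * ‖w‖ := by
    filter_upwards [(hasDerivAt_iff_isLittleO.1 hk).def (sub_pos.2 hq0)] with w hw
    rw [hk0, sub_zero, sub_zero, smul_eq_mul] at hw
    calc ‖k w‖ = ‖(k w - w * (deriv h 0)⁻¹) + w * (deriv h 0)⁻¹‖ := by rw [sub_add_cancel]
      _ ≤ (q - ‖(deriv h 0)⁻¹‖) * ‖w‖ + ‖w‖ * ‖(deriv h 0)⁻¹‖ := by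
        refine (norm_add_le _ _).trans ?_
        rw [norm_mul]
        gcongr
      _ = q * ‖w‖ := by ring
  obtain ⟨ρ, hρ, hball⟩ := nhds_basis_closedBall.mem_iff.1 (hright.and hlip)
  have hqpos : 0 < q := (norm_nonneg _).trans_lt hq0
  refine ⟨min ρ (1 / 2), by positivity, by linarith [min_le_right ρ (1 / 2)], q, hqpos, hq1,
    fun w hw => ?_⟩
  obtain ⟨h1, h2⟩ := hball (mem_closedBall_zero_iff.2 (hw.trans (min_le_left _ _)))
  refine ⟨k w, mem_ball_zero_iff.2 (h2.trans_lt ?_), h1, h2⟩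
  have := hw.trans (min_le_right _ _)
  nlinarith [norm_nonneg w]

/-- A lower bound for the area, with respect to the density `‖w‖⁻²`, of the image of the annulus
`a < ‖ζ‖ < 1` under an injective map whose logarithmic derivative is that of `h` up to sign. -/
theorem le_logArea_image {h H : ℂ → ℂ} {a : ℝ} (ha : 0 < a) (ha1 : a ≤ 1)
    (hd : DifferentiableOn ℂ h (ball 0 1)) (hinj : InjOn h (ball 0 1)) (h0 : h 0 = 0)
    (hder : deriv h 0 ≠ 0) (hHd : DifferentiableOn ℂ H (annulus a 1))
    (hHinj : InjOn H (annulus a 1))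
    (hH : ∀ z ∈ annulus a 1, (deriv H z / H z) ^ 2 = (deriv h z / h z) ^ 2) :
    ENNReal.ofReal (2 * π * Real.log (1 / a)) ≤ ∫⁻ w in H '' annulus a 1, ‖1 / w ^ 2‖ₑ := by
  have h0m : (0 : ℂ) ∈ ball (0 : ℂ) 1 := mem_ball_self one_pos
  have hslope : ∀ z ≠ 0, dslope h 0 z = h z / z := fun z hz => by
    rw [dslope_of_ne _ hz, slope_def_field, h0, sub_zero, sub_zero]
  have hne : ∀ z ∈ ball (0 : ℂ) 1, dslope h 0 z ≠ 0 := by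
    intro z hz
    rcases eq_or_ne z 0 with rfl | hz0
    · rwa [dslope_same]
    · rw [hslope z hz0]
      refine div_ne_zero (fun hh => hz0 (hinj hz h0m (hh.trans h0.symm))) hz0
  -- `g ζ = (ζ h'(ζ) / h(ζ)) ^ 2` extends holomorphically to `0` with the value `1`
  set g : ℂ → ℂ := fun z => (deriv h z / dslope h 0 z) ^ 2
  have hg : DifferentiableOn ℂ g (ball 0 1) :=
    ((hd.deriv isOpen_ball).div ((Complex.differentiableOn_dslope
      (isOpen_ball.mem_nhds h0m)).2 hd) hne).pow 2
  have hg0 : g 0 = 1 := by simp [g, dslope_same, hder]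
  rw [lintegral_image_holomorphic (isOpen_annulus a 1) hHd hHinj]
  have h1 := le_lintegral_annulus ha ha1 hg
  rw [hg0, enorm_one, mul_one] at h1
  refine h1.trans (le_of_eq (setLIntegral_congr_fun (isOpen_annulus a 1).measurableSet
    fun z hz => ?_))
  have hz0 : z ≠ 0 := norm_pos_iff.1 (ha.trans hz.1)
  rw [← enorm_mul]
  congr 1
  rw [mul_one_div, ← div_pow (deriv H z), hH z hz, ← div_pow, hslope z hz0, div_div,
    div_mul_cancel₀ _ hz0]

/-- An injective holomorphic function `h` on the unit disc with `h 0 = 0` whose image is disjoint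
from its image under inversion satisfies `‖h' 0‖ ≤ 1`. If `‖h' 0‖ > 1`, the images of an annulus
`q * ρ < ‖ζ‖ < 1` under `h` and `1 / h` would be disjoint subsets of `ρ < ‖w‖ < ρ⁻¹` with total
area, for the density `‖w‖⁻²`, exceeding that of the latter annulus. -/
theorem norm_deriv_le_one_of_mul_ne_one {h : ℂ → ℂ} (hd : DifferentiableOn ℂ h (ball 0 1))
    (hinj : InjOn h (ball 0 1)) (h0 : h 0 = 0)
    (hmul : ∀ x ∈ ball (0 : ℂ) 1, ∀ y ∈ ball (0 : ℂ) 1, h x * h y ≠ 1) : ‖deriv h 0‖ ≤ 1 := by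
  by_contra! hder
  obtain ⟨ρ, hρ, hρ1, q, hq, hq1, hpre⟩ := exists_preimage_norm_le hd h0 hder
  have hqρ : 0 < q * ρ := by positivity
  have hqρ1 : q * ρ ≤ 1 := by nlinarith
  set A := annulus (q * ρ) 1
  have hA : A ⊆ ball 0 1 := fun z hz => mem_ball_zero_iff.2 hz.2
  have hlow : ∀ z ∈ A, ρ < ‖h z‖ := by
    intro z hz
    by_contra! hle
    obtain ⟨ζ, hζ, hζz, hζn⟩ := hpre (h z) hle
    rw [hinj hζ (hA hz) hζz] at hζn
    have := hz.1
    nlinarith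
  have hupp : ∀ z ∈ A, ‖h z‖ < ρ⁻¹ := by
    intro z hz
    by_contra! hle
    have hpos : 0 < ‖h z‖ := hρ.trans (hlow z hz)
    obtain ⟨ζ, hζ, hζz, -⟩ := hpre (h z)⁻¹ (by
      rw [norm_inv]
      exact inv_le_of_inv_le₀ hρ hle)
    exact hmul ζ hζ z (hA hz) (by rw [hζz, inv_mul_cancel₀ (norm_pos_iff.1 hpos)])
  have hne : ∀ z ∈ A, h z ≠ 0 := fun z hz => norm_pos_iff.1 (hρ.trans (hlow z hz))
  have hdA : DifferentiableOn ℂ h A := hd.mono hA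
  have hder0 : deriv h 0 ≠ 0 := norm_pos_iff.1 (zero_lt_one.trans hder)
  have e1 := le_logArea_image hqρ hqρ1 hd hinj h0 hder0 hdA (hinj.mono hA) fun _ _ => rfl
  have e2 := le_logArea_image (H := fun z => (h z)⁻¹) hqρ hqρ1 hd hinj h0 hder0 (hdA.inv hne)
    (fun x hx y hy hxy => hinj (hA hx) (hA hy) (inv_injective hxy)) fun z hz => by
      have hz' := hne z hz
      rw [((hdA.differentiableAt ((isOpen_annulus _ _).mem_nhds hz)).hasDerivAt.fun_inv hz').deriv]
      field_simp
  have hdisj : Disjoint (h '' A) ((fun z => (h z)⁻¹) '' A) := by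
    rw [Set.disjoint_left]
    rintro _ ⟨x, hx, rfl⟩ ⟨y, hy, hxy⟩
    refine hmul x (hA hx) y (hA hy) ?_
    rw [← show (h y)⁻¹ = h x from hxy, inv_mul_cancel₀ (hne y hy)]
  have hmeas : MeasurableSet ((fun z => (h z)⁻¹) '' A) :=
    measurable_image_of_fderivWithin (isOpen_annulus _ _).measurableSet
      (fun z hz => ((((hdA.inv hne).differentiableAt
        ((isOpen_annulus _ _).mem_nhds hz)).hasDerivAt.complexToReal_fderiv).hasFDerivWithinAt))
      (fun x hx y hy hxy => hinj (hA hx) (hA hy) (inv_injective hxy))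
  have hsub : h '' A ∪ (fun z => (h z)⁻¹) '' A ⊆ annulus ρ ρ⁻¹ := by
    rintro _ (⟨z, hz, rfl⟩ | ⟨z, hz, rfl⟩)
    · exact ⟨hlow z hz, hupp z hz⟩
    · have hpos : 0 < ‖h z‖ := hρ.trans (hlow z hz)
      refine ⟨?_, ?_⟩
      · rw [norm_inv]
        exact lt_inv_of_lt_inv₀ hpos (hupp z hz)
      · rw [norm_inv]
        exact (inv_lt_inv₀ hpos hρ).2 (hlow z hz)
  have htot : ENNReal.ofReal (2 * π * Real.log (1 / (q * ρ)) + 2 * π * Real.log (1 / (q * ρ))) ≤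
      ENNReal.ofReal (2 * π * Real.log (ρ⁻¹ / ρ)) := by
    rw [← logArea_annulus hρ (hρ1.le.trans ((one_le_inv₀ hρ).2 hρ1.le))]
    refine le_trans ?_ (lintegral_mono_set hsub)
    rw [lintegral_union hmeas hdisj, ENNReal.ofReal_add]
    · exact add_le_add e1 e2
    all_goals
      have := Real.log_nonneg ((one_le_div hqρ).2 hqρ1)
      positivity
  have hlog1 : 0 < Real.log (ρ⁻¹ / ρ) := by
    refine Real.log_pos ?_
    rw [lt_div_iff₀ hρ, one_mul]
    exact hρ1.trans ((one_lt_inv₀ hρ).2 hρ1)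
  rw [ENNReal.ofReal_le_ofReal_iff (by positivity)] at htot
  rw [one_div, Real.log_inv, Real.log_mul hq.ne' hρ.ne', Real.log_div (inv_ne_zero hρ.ne') hρ.ne',
    Real.log_inv] at htot
  have := Real.log_neg hq hq1
  nlinarith [Real.pi_pos]

/-- The **Koebe quarter theorem** for an injective function without zeros. -/
theorem norm_deriv_zero_le_of_injOn_ne_zero {g : ℂ → ℂ} (hd : DifferentiableOn ℂ g (ball 0 1))
    (hinj : InjOn g (ball 0 1)) (hg0 : ∀ z ∈ ball (0 : ℂ) 1, g z ≠ 0) :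
    ‖deriv g 0‖ ≤ 4 * ‖g 0‖ := by
  have h0m : (0 : ℂ) ∈ ball (0 : ℂ) 1 := mem_ball_self one_pos
  have hsc : IsSimplyConnected (ball (0 : ℂ) 1) := by
    have := (convex_ball (0 : ℂ) 1).contractibleSpace ⟨0, h0m⟩
    exact (inferInstance : SimplyConnectedSpace (ball (0 : ℂ) 1))
  obtain ⟨s, hsd, hs⟩ := exists_differentiableOn_sqrt isOpen_ball hsc hd hg0
  have hs0 : s 0 ≠ 0 := fun h => hg0 0 h0m (by rw [← hs, h]; simp)
  have hadd : ∀ x ∈ ball (0 : ℂ) 1, ∀ y ∈ ball (0 : ℂ) 1, s x + s y ≠ 0 := by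
    intro x hx y hy h
    have hxy : s x = -s y := eq_neg_of_add_eq_zero_left h
    obtain rfl : x = y := hinj hx hy (by rw [← hs, ← hs, hxy, neg_sq])
    refine hg0 x hx ?_
    rw [← hs, self_eq_neg.1 hxy]
    simp
  have hsd0 : HasDerivAt s (deriv s 0) 0 :=
    (hsd.differentiableAt (isOpen_ball.mem_nhds h0m)).hasDerivAt
  have hgs : 2 * s 0 * deriv s 0 = deriv g 0 := by
    have h1 := hsd0.fun_pow 2
    simp only [hs] at h1
    simpa using h1.unique (hd.differentiableAt (isOpen_ball.mem_nhds h0m)).hasDerivAt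
  have h2 : s 0 + s 0 ≠ 0 := hadd 0 h0m 0 h0m
  have key := norm_deriv_le_one_of_mul_ne_one (h := fun z => (s z - s 0) / (s z + s 0))
    ((hsd.sub_const _).div (hsd.add_const _) fun z hz => hadd z hz 0 h0m) (fun x hx y hy h => ?_)
    (by simp) fun x hx y hy h => ?_
  · have hder : HasDerivAt (fun z => (s z - s 0) / (s z + s 0)) (deriv g 0 / (4 * g 0)) 0 := by
      refine ((hsd0.sub_const _).fun_div (hsd0.add_const _) h2).congr_deriv ?_
      rw [← hgs, ← hs]
      field_simp
      ring
    rw [hder.deriv, norm_div, norm_mul, Complex.norm_ofNat,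
      div_le_one (mul_pos four_pos (norm_pos_iff.2 (hg0 0 h0m)))] at key
    exact key
  · simp only at h
    rw [div_eq_div_iff (hadd x hx 0 h0m) (hadd y hy 0 h0m)] at h
    have h3 : (s 0 + s 0) * (s x - s y) = 0 := by linear_combination h
    have h4 := sub_eq_zero.1 ((mul_eq_zero.1 h3).resolve_left h2)
    exact hinj hx hy (by rw [← hs, ← hs, h4])
  · rw [div_mul_div_comm, div_eq_one_iff_eq (mul_ne_zero (hadd x hx 0 h0m) (hadd y hy 0 h0m))] at h
    have h3 : (s 0 + s 0) * (s x + s y) = 0 := by linear_combination -h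
    exact (mul_ne_zero h2 (hadd x hx y hy)) h3

/-- The quarter theorem recentred at a point `u` of the disc by a disc automorphism. The constant
`4` is sharp, and the exponent in the growth estimate depends on it. -/
theorem norm_deriv_mul_le_four_mul {f : ℂ → ℂ} (hd : DifferentiableOn ℂ f (ball 0 1))
    (hinj : InjOn f (ball 0 1)) {a : ℂ} (ha : a ∉ f '' ball 0 1) {u : ℂ} (hu : ‖u‖ < 1) :
    ‖deriv f u‖ * (1 - ‖u‖ ^ 2) ≤ 4 * ‖f u - a‖ := by
  have hu' : ‖-u‖ < 1 := by rwa [norm_neg]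
  have h0 : discShift (-u) 0 = u := by rw [discShift_zero, neg_neg]
  have hmaps := mapsTo_discShift hu'
  have h1 := norm_deriv_zero_le_of_injOn_ne_zero (g := fun z => f (discShift (-u) z) - a)
    ((hd.comp (differentiableOn_discShift hu') hmaps).sub_const a)
    (fun x hx y hy h => injOn_discShift hu' hx hy
      (hinj (hmaps hx) (hmaps hy) (sub_left_injective h)))
    (fun z hz h => ha ⟨_, hmaps hz, sub_eq_zero.1 h⟩)
  have hfd : HasDerivAt f (deriv f u) (discShift (-u) 0) := by
    rw [h0]
    exact (hd.differentiableAt (isOpen_ball.mem_nhds (mem_ball_zero_iff.2 hu))).hasDerivAt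
  have hder := ((hfd.comp 0 (hasDerivAt_discShift hu' (by simp))).sub_const a).deriv
  simp only [Function.comp_def] at hder
  rw [hder, h0, mul_zero, sub_zero, one_pow, div_one, norm_neg, norm_mul] at h1
  refine le_trans (le_of_eq ?_) h1
  congr 1
  norm_cast
  rw [Real.norm_of_nonneg]
  nlinarith [norm_nonneg u]

/-! ### Growth along radii -/

/-- The quarter theorem bounds the variation of `log ‖f (t * ζ) - a‖ ^ 2` along the radius to `ζ` by
that of `4 * log ((1 + t * ‖ζ‖) / (1 - t * ‖ζ‖))`. -/
theorem abs_log_sub_log_le {f : ℂ → ℂ} (hd : DifferentiableOn ℂ f (ball 0 1))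
    (hinj : InjOn f (ball 0 1)) {a : ℂ} (ha : a ∉ f '' ball 0 1) {ζ : ℂ} (hζ : ‖ζ‖ < 1) {s t : ℝ}
    (hs : 0 ≤ s) (hst : s ≤ t) (ht : t ≤ 1) :
    |Real.log (‖f (t * ζ) - a‖ ^ 2) - Real.log (‖f (s * ζ) - a‖ ^ 2)| ≤
      4 * (Real.log (1 + t * ‖ζ‖) - Real.log (1 - t * ‖ζ‖)) -
        4 * (Real.log (1 + s * ‖ζ‖) - Real.log (1 - s * ‖ζ‖)) := by
  set R := ‖ζ‖
  have hR0 : 0 ≤ R := norm_nonneg ζ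
  have htR : ∀ x ∈ Icc (0 : ℝ) 1, 0 ≤ x * R ∧ x * R < 1 := fun x hx =>
    ⟨mul_nonneg hx.1 hR0, by nlinarith [hx.1, hx.2]⟩
  have hnorm : ∀ x ∈ Icc (0 : ℝ) 1, ‖(x : ℂ) * ζ‖ = x * R := fun x hx => by
    rw [norm_mul, Complex.norm_real, Real.norm_of_nonneg hx.1]
  have hmem : ∀ x ∈ Icc (0 : ℝ) 1, (x : ℂ) * ζ ∈ ball (0 : ℂ) 1 := fun x hx => by
    rw [mem_ball_zero_iff, hnorm x hx]
    exact (htR x hx).2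
  set N : ℝ → ℝ := fun x => ‖f (x * ζ) - a‖ ^ 2
  set M : ℝ → ℝ := fun x => 4 * (Real.log (1 + x * R) - Real.log (1 - x * R))
  have hpos : ∀ x ∈ Icc (0 : ℝ) 1, 0 < ‖f (x * ζ) - a‖ := fun x hx =>
    norm_pos_iff.2 fun h => ha ⟨_, hmem x hx, sub_eq_zero.1 h⟩
  have hL : ∀ x ∈ Icc (0 : ℝ) 1, ∃ l, HasDerivAt (fun x => Real.log (N x)) l x ∧
      |l| ≤ 8 * R / (1 - (x * R) ^ 2) := by
    intro x hx
    have h1 : HasDerivAt (fun x : ℝ => (x : ℂ) * ζ) (1 * ζ) x :=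
      (Complex.ofRealCLM.hasDerivAt (x := x)).mul_const ζ
    have h2 := (((hd.differentiableAt (isOpen_ball.mem_nhds (hmem x hx))).hasDerivAt).comp x
      h1).sub_const a
    have h3 := h2.norm_sq.log (pow_ne_zero 2 (hpos x hx).ne')
    refine ⟨_, h3, ?_⟩
    have hx2 : 0 < 1 - (x * R) ^ 2 := by nlinarith [htR x hx]
    have hk := norm_deriv_mul_le_four_mul hd hinj ha (mem_ball_zero_iff.1 (hmem x hx))
    rw [hnorm x hx] at hk
    have hin := abs_real_inner_le_norm (f (x * ζ) - a) (deriv f (x * ζ) * (1 * ζ))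
    rw [one_mul, norm_mul] at hin
    simp only [Function.comp_def]
    rw [abs_div, abs_of_pos (pow_pos (hpos x hx) 2), abs_mul, abs_two, one_mul,
      div_le_div_iff₀ (pow_pos (hpos x hx) 2) hx2]
    have hp := hpos x hx
    calc 2 * |inner ℝ (f (x * ζ) - a) (deriv f (x * ζ) * ζ)| * (1 - (x * R) ^ 2)
        ≤ 2 * (‖f (x * ζ) - a‖ * (‖deriv f (x * ζ)‖ * R)) * (1 - (x * R) ^ 2) := by gcongr
      _ = 2 * R * ‖f (x * ζ) - a‖ * (‖deriv f (x * ζ)‖ * (1 - (x * R) ^ 2)) := by ring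
      _ ≤ 2 * R * ‖f (x * ζ) - a‖ * (4 * ‖f (x * ζ) - a‖) := by gcongr
      _ = 8 * R * ‖f (x * ζ) - a‖ ^ 2 := by ring
  have hM : ∀ x ∈ Icc (0 : ℝ) 1, HasDerivAt M (8 * R / (1 - (x * R) ^ 2)) x := by
    intro x hx
    obtain ⟨h1, h2⟩ := htR x hx
    have e1 := (((hasDerivAt_id x).mul_const R).const_add 1).log (by simp only [id]; linarith)
    have e2 := (((hasDerivAt_id x).mul_const R).const_sub 1).log (by simp only [id]; linarith)
    refine ((e1.sub e2).const_mul 4).congr_deriv ?_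
    have hp : 1 + x * R ≠ 0 := by linarith
    have hq : 1 - x * R ≠ 0 := by linarith
    rw [show 1 - (x * R) ^ 2 = (1 + x * R) * (1 - x * R) by ring, eq_div_iff (mul_ne_zero hp hq)]
    simp only [id, one_mul]
    linear_combination 4 * R * (1 - x * R) * inv_mul_cancel₀ hp +
      4 * R * (1 + x * R) * inv_mul_cancel₀ hq
  choose! l hl hlb using hL
  -- `σ = 1` and `σ = -1` give the two halves of the bound on the absolute value
  have hmono : ∀ σ : ℝ, |σ| ≤ 1 → MonotoneOn (fun x => M x + σ * Real.log (N x)) (Icc 0 1) := by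
    intro σ hσ
    have hder : ∀ x ∈ Icc (0 : ℝ) 1, HasDerivAt (fun x => M x + σ * Real.log (N x))
        (8 * R / (1 - (x * R) ^ 2) + σ * l x) x := fun x hx => (hM x hx).add ((hl x hx).const_mul σ)
    refine monotoneOn_of_deriv_nonneg (convex_Icc 0 1)
      (fun x hx => (hder x hx).continuousAt.continuousWithinAt)
      (fun x hx => (hder x (interior_subset hx)).differentiableAt.differentiableWithinAt)
      fun x hx => ?_
    have hx' := interior_subset hx
    rw [(hder x hx').deriv]
    have h1 : |σ * l x| ≤ 8 * R / (1 - (x * R) ^ 2) := by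
      rw [abs_mul]
      exact (mul_le_of_le_one_left (abs_nonneg _) hσ).trans (hlb x hx')
    linarith [neg_abs_le (σ * l x)]
  have hs' : s ∈ Icc (0 : ℝ) 1 := ⟨hs, hst.trans ht⟩
  have ht' : t ∈ Icc (0 : ℝ) 1 := ⟨hs.trans hst, ht⟩
  have m1 := hmono 1 (by simp) hs' ht' hst
  have m2 := hmono (-1) (by simp) hs' ht' hst
  simp only [M, N] at m1 m2
  rw [abs_le]
  constructor <;> linarith

/-- For a point on the radius from `0` to `ζ`, the growth estimates from its two ends multiply to
one that involves only `‖ζ‖`. -/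
theorem norm_sub_mul_norm_sub_le {f : ℂ → ℂ} (hd : DifferentiableOn ℂ f (ball 0 1))
    (hinj : InjOn f (ball 0 1)) {a b : ℂ} (ha : a ∉ f '' ball 0 1) (hb : b ∉ f '' ball 0 1) {ζ : ℂ}
    (hζ : ‖ζ‖ < 1) {t : ℝ} (ht : t ∈ Icc (0 : ℝ) 1) :
    ‖f (t * ζ) - a‖ * ‖f (t * ζ) - b‖ ≤
      ‖f 0 - a‖ * ‖f ζ - b‖ * ((1 + ‖ζ‖) / (1 - ‖ζ‖)) ^ 2 := by
  have hmem : (t : ℂ) * ζ ∈ ball (0 : ℂ) 1 := by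
    rw [mem_ball_zero_iff, norm_mul, Complex.norm_real, Real.norm_of_nonneg ht.1]
    nlinarith [norm_nonneg ζ, ht.1, ht.2]
  have hne : ∀ c, c ∉ f '' ball 0 1 → ∀ u ∈ ball (0 : ℂ) 1, 0 < ‖f u - c‖ := fun c hc u hu =>
    norm_pos_iff.2 fun h => hc ⟨u, hu, sub_eq_zero.1 h⟩
  have pa := hne a ha _ hmem
  have pb := hne b hb _ hmem
  have pa0 := hne a ha 0 (mem_ball_self one_pos)
  have pbζ := hne b hb ζ (mem_ball_zero_iff.2 hζ)
  have h1 := (le_abs_self _).trans (abs_log_sub_log_le hd hinj ha hζ le_rfl ht.1 ht.2)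
  have h2 := (neg_le_abs _).trans (abs_log_sub_log_le hd hinj hb hζ ht.1 ht.2 le_rfl)
  have hR : 0 < 1 - ‖ζ‖ := by linarith
  have hR' : 0 < 1 + ‖ζ‖ := by linarith [norm_nonneg ζ]
  simp only [Complex.ofReal_zero, zero_mul, Complex.ofReal_one, one_mul, add_zero, sub_zero,
    Real.log_pow, Nat.cast_ofNat, Real.log_one, mul_zero] at h1 h2
  rw [← Real.log_le_log_iff (by positivity) (by positivity), Real.log_mul pa.ne' pb.ne',
    Real.log_mul (by positivity) (by positivity), Real.log_mul pa0.ne' pbζ.ne', Real.log_pow,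
    Real.log_div hR'.ne' hR.ne', Nat.cast_ofNat]
  linarith

/-! ### The Bergman kernel of a simply connected domain -/

/-- The area form of the mean value property for integrable holomorphic functions on the disc. -/
theorem integral_unitBall_eq {h : ℂ → ℂ} (hd : DifferentiableOn ℂ h (ball 0 1))
    (hint : IntegrableOn h (ball 0 1)) : ∫ z in ball (0 : ℂ) 1, h z = π * h 0 := by
  have hsub : annulus 0 1 ⊆ ball (0 : ℂ) 1 := fun z hz => mem_ball_zero_iff.2 hz.2
  have hae : (annulus 0 1 : Set ℂ) =ᵐ[volume] ball (0 : ℂ) 1 := by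
    have : annulus 0 1 = ball (0 : ℂ) 1 \ {0} := by
      ext z
      simp [annulus, and_comm]
    rw [this]
    exact sdiff_null_ae_eq_self (measure_singleton 0)
  have hcont : ContinuousOn (fun p : ℝ × ℝ => p.1 • h (circleMap 0 p.1 p.2))
      (Ioo 0 1 ×ˢ Ioo (-π) π) :=
    continuous_fst.continuousOn.smul
      (continuousOn_comp_circleMap le_rfl (hd.continuousOn.mono hsub))
  have hint' : IntegrableOn (fun p : ℝ × ℝ => p.1 • h (circleMap 0 p.1 p.2))
      (Ioo 0 1 ×ˢ Ioo (-π) π) := by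
    refine ⟨hcont.aestronglyMeasurable (measurableSet_Ioo.prod measurableSet_Ioo), ?_⟩
    have h1 := (hint.mono_set hsub).2
    rw [HasFiniteIntegral, lintegral_annulus_eq_prod le_rfl] at h1
    refine lt_of_eq_of_lt (setLIntegral_congr_fun (measurableSet_Ioo.prod measurableSet_Ioo)
      fun p hp => ?_) h1
    simp only
    rw [enorm_smul, Real.enorm_of_nonneg hp.1.1.le]
  have hcircle : ∀ r ∈ Ioo (0 : ℝ) 1,
      ∫ θ in Ioo (-π) π, r • h (circleMap 0 r θ) = r • ((2 * π) • h 0) := by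
    intro r hr
    have h1 : Real.circleAverage h 0 r = h 0 := by
      apply DiffContOnCl.circleAverage
      rw [abs_of_pos hr.1]
      exact (hd.mono (closedBall_subset_ball hr.2)).diffContOnCl_ball subset_rfl
    have h2 := ((periodic_circleMap 0 r).comp h).intervalIntegral_add_eq 0 (-π)
    simp only [zero_add, Function.comp_def] at h2
    rw [integral_smul, ← integral_Ioc_eq_integral_Ioo, ← intervalIntegral.integral_of_le
      (by linarith [Real.pi_pos]), ← h1, Real.circleAverage_def, smul_smul (2 * π),
      mul_inv_cancel₀ (by positivity), one_smul, h2]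
    congr 3
    ring
  rw [← setIntegral_congr_set hae, integral_annulus_eq_prod le_rfl, Measure.volume_eq_prod,
    setIntegral_prod _ hint', setIntegral_congr_fun measurableSet_Ioo hcircle,
    integral_smul_const, ← integral_Ioc_eq_integral_Ioo,
    ← intervalIntegral.integral_of_le zero_le_one, integral_id]
  simp only [Complex.real_smul]
  push_cast
  ring

theorem IsDiscEmbedding.exists_inverse {U : Set ℂ} (hU : IsOpen U) {w : ℂ} {F : ℂ → ℂ}
    (hF : IsDiscEmbedding U w F) (hsurj : F '' U = ball 0 1) :
    ∃ f : ℂ → ℂ, f '' ball 0 1 = U ∧ InjOn f (ball 0 1) ∧ (∀ z ∈ U, f (F z) = z) ∧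
      ∀ u ∈ ball (0 : ℂ) 1, HasDerivAt f (deriv F (f u))⁻¹ u := by
  have hleft : ∀ z ∈ U, Function.invFunOn F U (F z) = z := fun z hz =>
    hF.injOn.leftInvOn_invFunOn hz
  have hmem : ∀ u ∈ ball (0 : ℂ) 1, Function.invFunOn F U u ∈ U := fun u hu =>
    Function.invFunOn_mem (hsurj.symm ▸ hu : u ∈ F '' U)
  have hright : ∀ u ∈ ball (0 : ℂ) 1, F (Function.invFunOn F U u) = u := fun u hu =>
    Function.invFunOn_eq (hsurj.symm ▸ hu : u ∈ F '' U)
  refine ⟨Function.invFunOn F U, ?_, fun x hx y hy h => ?_, hleft, fun u hu => ?_⟩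
  · ext z
    constructor
    · rintro ⟨u, hu, rfl⟩
      exact hmem u hu
    · exact fun hz => ⟨F z, hF.mapsTo hz, hleft z hz⟩
  · rw [← hright x hx, ← hright y hy, h]
  · set z := Function.invFunOn F U u with hz
    have hzU : z ∈ U := hmem u hu
    have hs : HasStrictDerivAt F (deriv F z) z :=
      (hF.differentiableOn.analyticOnNhd hU z hzU).hasStrictDerivAt
    refine HasDerivAt.of_local_left_inverse ?_ hs.hasDerivAt (hF.deriv_ne_zero z hzU) ?_
    · intro V hV
      rw [← hz] at hV
      have h1 : F '' (V ∩ U) ∈ 𝓝 u := by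
        rw [← hright u hu, ← hz, ← hs.map_nhds_eq (hF.deriv_ne_zero z hzU)]
        exact image_mem_map (inter_mem hV (hU.mem_nhds hzU))
      rw [mem_map]
      filter_upwards [h1]
      rintro _ ⟨y, ⟨hyV, hyU⟩, rfl⟩
      rw [mem_preimage, hleft y hyU]
      exact hyV
    · filter_upwards [isOpen_ball.mem_nhds hu] with v hv using hright v hv

/-- The squared `L²` norm of `F'` is the area of the image of `F`, which lies in the unit disc. -/
theorem memLp_deriv_of_isDiscEmbedding {U : Set ℂ} (hU : IsOpen U) {w : ℂ} {F : ℂ → ℂ}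
    (hF : IsDiscEmbedding U w F) : MemLp (deriv F) 2 (volume.restrict U) := by
  have hcont : ContinuousOn (deriv F) U := (hF.differentiableOn.deriv hU).continuousOn
  refine (memLp_two_iff_integrable_sq_norm (hcont.aestronglyMeasurable hU.measurableSet)).2
    ⟨(hcont.norm.pow 2).aestronglyMeasurable hU.measurableSet, ?_⟩
  have h1 := lintegral_image_holomorphic hU hF.differentiableOn hF.injOn 1
  simp only [Pi.one_apply, mul_one, lintegral_one, Measure.restrict_apply_univ] at h1
  rw [HasFiniteIntegral]
  simp only [enorm_pow, enorm_norm]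
  simp only [enorm_pow] at h1
  rw [← h1]
  exact (measure_mono hF.mapsTo.image_subset).trans_lt measure_ball_lt_top

/-- The Bergman kernel in terms of a Riemann map sending `w` to `0`. -/
theorem bergmanKernel_eq_of_riemann_map {Ω : TopologicalSpace.Opens ℂ} {z w : Ω} {F : ℂ → ℂ}
    (hF : IsDiscEmbedding Ω w F) (hsurj : F '' Ω = ball 0 1) :
    bergmanKernel Ω z w = conj (deriv F w) / π * deriv F z := by
  obtain ⟨f, hfim, hfinj, hleft, hfd⟩ := hF.exists_inverse Ω.isOpen hsurj
  have hFd := hF.differentiableOn.deriv Ω.isOpen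
  have hf0 : f 0 = w := by rw [← hF.map_base, hleft w w.2]
  have h0m : (0 : ℂ) ∈ ball (0 : ℂ) 1 := mem_ball_self one_pos
  have hfmem : ∀ u ∈ ball (0 : ℂ) 1, f u ∈ (Ω : Set ℂ) := fun u hu => hfim ▸ mem_image_of_mem f hu
  have hfdiff : DifferentiableOn ℂ f (ball 0 1) := fun u hu =>
    (hfd u hu).differentiableAt.differentiableWithinAt
  have hLp := memLp_deriv_of_isDiscEmbedding Ω.isOpen hF
  set c : ℂ := conj (deriv F w) / π
  have hK2 : MemLp (fun ζ => c * deriv F ζ) 2 (volume.restrict (Ω : Set ℂ)) := hLp.const_mul c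
  let K : bergmanSpace Ω := ⟨hK2.toLp, _, hFd.const_mul c, hK2.coeFn_toLp⟩
  -- the reproducing property: substitute `ζ = f u` and apply the mean value property on the disc
  have hrepr : ∀ g : bergmanSpace Ω, inner ℂ K g = g w := by
    intro g
    set G := bergmanSpace.rep g
    have hGd : DifferentiableOn ℂ G Ω := bergmanSpace.differentiableOn_rep g
    have hae : (fun ζ => inner ℂ ((K : Lp ℂ 2 (volume.restrict (Ω : Set ℂ))) ζ)
        ((g : Lp ℂ 2 (volume.restrict (Ω : Set ℂ))) ζ)) =ᵐ[volume.restrict (Ω : Set ℂ)]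
        fun ζ => conj (c * deriv F ζ) * G ζ := by
      filter_upwards [hK2.coeFn_toLp, bergmanSpace.ae_eq_rep g] with ζ h1 h2
      rw [h2, show (K : Lp ℂ 2 (volume.restrict (Ω : Set ℂ))) ζ = _ from h1, RCLike.inner_apply,
        mul_comm]
    have hint : IntegrableOn (fun ζ => conj (c * deriv F ζ) * G ζ) (f '' ball 0 1) := by
      rw [hfim]
      exact (integrable_congr hae).1 (L2.integrable_inner _ _)
    have hpull : EqOn (fun u => |((deriv F (f u))⁻¹ • (1 : ℂ →L[ℝ] ℂ)).det| •
        (conj (c * deriv F (f u)) * G (f u)))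
        (fun u => conj c * ((deriv F (f u))⁻¹ * G (f u))) (ball 0 1) := by
      intro u hu
      have hne := hF.deriv_ne_zero _ (hfmem u hu)
      have hne' : conj (deriv F (f u)) ≠ 0 := (map_ne_zero _).2 hne
      simp only
      rw [det_complex_smul_one, abs_of_nonneg (by positivity), Complex.real_smul]
      push_cast
      rw [← Complex.conj_mul', map_inv₀, map_mul]
      field_simp
    have hder : ∀ u ∈ ball (0 : ℂ) 1, HasFDerivWithinAt f
        ((deriv F (f u))⁻¹ • (1 : ℂ →L[ℝ] ℂ)) (ball 0 1) u := fun u hu =>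
      (hfd u hu).complexToReal_fderiv.hasFDerivWithinAt
    have hcomp : DifferentiableOn ℂ (fun u => conj c * ((deriv F (f u))⁻¹ * G (f u)))
        (ball 0 1) :=
      (((hFd.comp hfdiff hfmem).inv fun u hu => hF.deriv_ne_zero _ (hfmem u hu)).mul
        (hGd.comp hfdiff hfmem)).const_mul _
    have hint' := (integrableOn_congr_fun hpull measurableSet_ball).1
      ((integrableOn_image_iff_integrableOn_abs_det_fderiv_smul volume measurableSet_ball hder
        hfinj _).1 hint)
    have hw : deriv F w ≠ 0 := hF.deriv_ne_zero w w.2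
    have hπ : (π : ℂ) ≠ 0 := Complex.ofReal_ne_zero.2 Real.pi_ne_zero
    calc inner ℂ K g = ∫ ζ in (Ω : Set ℂ), conj (c * deriv F ζ) * G ζ := by
          rw [Submodule.coe_inner, L2.inner_def]
          exact integral_congr_ae hae
      _ = ∫ ζ in f '' ball 0 1, conj (c * deriv F ζ) * G ζ := by rw [hfim]
      _ = ∫ u in ball (0 : ℂ) 1, conj c * ((deriv F (f u))⁻¹ * G (f u)) := by
          rw [integral_image_eq_integral_abs_det_fderiv_smul volume measurableSet_ball hder hfinj]
          exact setIntegral_congr_fun measurableSet_ball hpull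
      _ = G w := by
          rw [integral_unitBall_eq hcomp hint', hf0]
          simp only [c, map_div₀, Complex.conj_conj, Complex.conj_ofReal]
          field_simp
      _ = g w := rfl
  have hker : RKHS.kerFun (bergmanSpace Ω) w 1 = K := by
    refine ext_inner_right ℂ fun g => ?_
    rw [hrepr, RKHS.kerFun_inner, RCLike.inner_apply, map_one, mul_one]
  rw [bergmanKernel, ← RKHS.kerFun_apply, hker]
  exact bergmanSpace.eqOn_rep K (hFd.const_mul c) hK2.coeFn_toLp z.2

/-! ### The estimates -/

theorem ball_infDist_frontier_subset {U : Set ℂ} (hU : IsOpen U) {z : ℂ} (hz : z ∈ U) :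
    ball z (infDist z (frontier U)) ⊆ U := by
  rcases le_or_gt (infDist z (frontier U)) 0 with hd | hd
  · simp [ball_eq_empty.2 hd]
  refine isPreconnected_ball.subset_of_closure_inter_subset hU ⟨z, mem_ball_self hd, hz⟩ ?_
  rintro y ⟨hyc, hy⟩
  by_contra hyU
  have h1 := infDist_le_dist_of_mem (hU.frontier_eq ▸ ⟨hyc, hyU⟩ : y ∈ frontier U) (x := z)
  rw [mem_ball, dist_comm] at hy
  linarith

theorem exists_notMem_dist_eq_infDist_frontier {Ω : TopologicalSpace.Opens ℂ}
    {z : ℂ} (hd : 0 < infDist z (frontier (Ω : Set ℂ))) :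
    ∃ a ∉ (Ω : Set ℂ), ‖z - a‖ = infDist z (frontier (Ω : Set ℂ)) := by
  have hne : (frontier (Ω : Set ℂ)).Nonempty := by
    by_contra h
    rw [not_nonempty_iff_eq_empty] at h
    simp [h] at hd
  obtain ⟨a, ha, had⟩ := isClosed_frontier.exists_infDist_eq_dist hne z
  refine ⟨a, fun haΩ => ?_, by rw [had, dist_eq_norm]⟩
  have := Ω.isOpen.inter_frontier_eq
  exact (this ▸ (⟨haΩ, ha⟩ : a ∈ (Ω : Set ℂ) ∩ frontier Ω) : a ∈ (∅ : Set ℂ))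

/-- A bound valid for every open set: evaluation at a point whose distance to the
boundary exceeds `r` has norm at most `(√π * r)⁻¹` on the Bergman space. -/
theorem norm_bergmanKernel_le {Ω : TopologicalSpace.Opens ℂ} {z w : Ω} {r : ℝ} (hr : 0 < r)
    (hz : closedBall (z : ℂ) r ⊆ Ω) (hw : closedBall (w : ℂ) r ⊆ Ω) :
    ‖bergmanKernel Ω z w‖ ≤ (π * r ^ 2)⁻¹ := by
  have heval : ∀ (x : Ω) (_ : closedBall (x : ℂ) r ⊆ Ω) (K : bergmanSpace Ω),
      ‖K x‖ ≤ (√π * r)⁻¹ * ‖K‖ := fun x hx K =>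
    norm_le_of_holomorphic_Lp (bergmanSpace.differentiableOn_rep K) (bergmanSpace.ae_eq_rep K) hr hx
  set K := RKHS.kerFun (bergmanSpace Ω) w 1
  have hKw : ‖K‖ ^ 2 = ‖K w‖ := by
    have h : ((‖K‖ : ℝ) : ℂ) ^ 2 = K w := (inner_self_eq_norm_sq_to_K (𝕜 := ℂ) K).symm.trans
      ((RKHS.kerFun_inner w 1 K).trans (by rw [RCLike.inner_apply, map_one, mul_one]))
    rw [← h, norm_pow, Complex.norm_real, norm_norm]
  have hK : ‖K‖ ≤ (√π * r)⁻¹ := by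
    have h := heval w hw K
    rw [← hKw, sq] at h
    rcases (norm_nonneg K).eq_or_lt with h0 | h0
    · rw [← h0]; positivity
    · exact le_of_mul_le_mul_right h h0
  rw [bergmanKernel, ← RKHS.kerFun_apply]
  calc ‖K z‖ ≤ (√π * r)⁻¹ * (√π * r)⁻¹ := (heval z hz K).trans (by gcongr)
    _ = (π * r ^ 2)⁻¹ := by
      rw [← mul_inv, mul_mul_mul_comm, Real.mul_self_sqrt Real.pi_pos.le, sq]

/-- The Schwarz–Pick inequality on the largest disc about `z` inside `U`. -/
theorem IsDiscEmbedding.norm_deriv_le {U : Set ℂ} (hU : IsOpen U) {w z : ℂ} {F : ℂ → ℂ}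
    (hF : IsDiscEmbedding U w F) (hz : z ∈ U) (hd : 0 < infDist z (frontier U)) :
    ‖deriv F z‖ ≤ (1 - ‖F z‖ ^ 2) / infDist z (frontier U) := by
  have hsub := ball_infDist_frontier_subset hU hz
  have hFz : ‖F z‖ < 1 := mem_ball_zero_iff.1 (hF.mapsTo hz)
  have hpos : 0 < 1 - ‖F z‖ ^ 2 := by nlinarith [norm_nonneg (F z)]
  have hmaps : MapsTo (fun y => discShift (F z) (F y)) (ball z (infDist z (frontier U)))
      (closedBall (discShift (F z) (F z)) 1) := by
    rw [discShift_self]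
    exact fun y hy => ball_subset_closedBall (mapsTo_discShift hFz (hF.mapsTo (hsub hy)))
  have h1 := Complex.norm_deriv_le_div_of_mapsTo_ball
    ((differentiableOn_discShift hFz).comp (hF.differentiableOn.mono hsub)
      (hF.mapsTo.mono_left hsub)) hmaps hd
  have hder := (hasDerivAt_discShift hFz hFz).comp z
    (hF.differentiableOn.differentiableAt (hU.mem_nhds hz)).hasDerivAt
  rw [hder.deriv, Complex.conj_mul'] at h1
  have h2 : (1 - (‖F z‖ : ℂ) ^ 2) / (1 - (‖F z‖ : ℂ) ^ 2) ^ 2 * deriv F z =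
      deriv F z / ((1 - ‖F z‖ ^ 2 : ℝ) : ℂ) := by
    have : (1 - (‖F z‖ : ℂ) ^ 2) ≠ 0 := by exact_mod_cast hpos.ne'
    push_cast
    field_simp
  rw [h2, norm_div, Complex.norm_real, Real.norm_of_nonneg hpos.le, div_le_div_iff₀ hpos hd,
    one_mul] at h1
  rwa [le_div_iff₀ hd]

/-- Two points at distance at most `ε` from the boundary and far from each other have images under
a Riemann map that are far apart in the hyperbolic metric. The growth estimates are applied at a
point of the image of a radius that is equidistant from `z` and `w`. -/
theorem one_sub_norm_mul_le {Ω : TopologicalSpace.Opens ℂ} {z w : Ω} {F : ℂ → ℂ}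
    (hF : IsDiscEmbedding Ω w F) (hsurj : F '' Ω = ball 0 1) {ε : ℝ}
    (hz0 : 0 < infDist (z : ℂ) (frontier (Ω : Set ℂ)))
    (hz : infDist (z : ℂ) (frontier (Ω : Set ℂ)) ≤ ε)
    (hw0 : 0 < infDist (w : ℂ) (frontier (Ω : Set ℂ)))
    (hw : infDist (w : ℂ) (frontier (Ω : Set ℂ)) ≤ ε) :
    (1 - ‖F z‖) * ‖(z : ℂ) - w‖ ≤ 8 * ε := by
  obtain ⟨f, hfim, hfinj, hleft, hfd⟩ := hF.exists_inverse Ω.isOpen hsurj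
  have hf0 : f 0 = w := by rw [← hF.map_base, hleft w w.2]
  have hfz : f (F z) = z := hleft z z.2
  have hdiff : DifferentiableOn ℂ f (ball 0 1) := fun u hu =>
    (hfd u hu).differentiableAt.differentiableWithinAt
  have hε : 0 < ε := hz0.trans_le hz
  set R := ‖F z‖ with hRdef
  have hR0 : 0 ≤ R := norm_nonneg _
  have hR1 : R < 1 := mem_ball_zero_iff.1 (hF.mapsTo z.2)
  set D := ‖(z : ℂ) - w‖ with hD
  have hD0 : 0 ≤ D := norm_nonneg _
  -- for `D ≤ 4 * ε` the bound `1 - R ≤ 1` suffices; otherwise `a` and `b` lie within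
  -- `ε ≤ D / 4` of `z` and `w`, while `p` is at distance at least `D / 2` from both
  rcases le_total D (4 * ε) with hsmall | hlarge
  · nlinarith
  obtain ⟨a, ha, hza⟩ := exists_notMem_dist_eq_infDist_frontier hz0
  obtain ⟨b, hb, hwb⟩ := exists_notMem_dist_eq_infDist_frontier hw0
  have hmem : ∀ t ∈ Icc (0 : ℝ) 1, (t : ℂ) * F z ∈ ball (0 : ℂ) 1 := fun t ht => by
    rw [mem_ball_zero_iff, norm_mul, Complex.norm_real, Real.norm_of_nonneg ht.1]
    nlinarith [ht.1, ht.2]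
  have hcont : ContinuousOn (fun t : ℝ => f (t * F z)) (Icc 0 1) :=
    hdiff.continuousOn.comp (by fun_prop) hmem
  obtain ⟨t, ht, hteq⟩ : ∃ t ∈ Icc (0 : ℝ) 1, ‖f (t * F z) - w‖ - ‖f (t * F z) - z‖ = 0 := by
    refine intermediate_value_Icc zero_le_one
      ((hcont.sub continuousOn_const).norm.sub (hcont.sub continuousOn_const).norm) ⟨?_, ?_⟩
    · simp [hf0]
    · simp [hfz]
  set p := f (t * F z)
  have hpw : D / 2 ≤ ‖p - w‖ := by
    have h1 : D ≤ ‖p - w‖ + ‖p - z‖ := by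
      rw [hD, ← sub_sub_sub_cancel_left (w : ℂ) (z : ℂ) p]
      exact norm_sub_le _ _
    linarith
  have hpa : D / 4 ≤ ‖p - a‖ := by
    have h1 : ‖p - z‖ ≤ ‖p - a‖ + ‖(z : ℂ) - a‖ := by
      rw [← sub_sub_sub_cancel_right p (z : ℂ) a]
      exact norm_sub_le _ _
    linarith
  have hpb : D / 4 ≤ ‖p - b‖ := by
    have h1 : ‖p - w‖ ≤ ‖p - b‖ + ‖(w : ℂ) - b‖ := by
      rw [← sub_sub_sub_cancel_right p (w : ℂ) b]
      exact norm_sub_le _ _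
    linarith
  have hgrowth := norm_sub_mul_norm_sub_le hdiff hfinj (hfim ▸ hb) (hfim ▸ ha) hR1 ht
  rw [hf0, hfz, ← hRdef, hwb, hza, div_pow] at hgrowth
  have hR2 : 0 < 1 - R := by linarith
  have hsq : ((1 - R) * D) ^ 2 ≤ (8 * ε) ^ 2 := by
    have h1 : D / 4 * (D / 4) ≤ ε * ε * ((1 + R) ^ 2 / (1 - R) ^ 2) := by
      calc D / 4 * (D / 4) ≤ ‖p - b‖ * ‖p - a‖ := by gcongr
        _ ≤ _ := hgrowth
        _ ≤ _ := by gcongr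
    rw [mul_div_assoc' (ε * ε), le_div_iff₀ (by positivity)] at h1
    have h2 : (1 + R) ^ 2 ≤ 4 := by nlinarith
    have h3 : ε * ε * (1 + R) ^ 2 ≤ ε * ε * 4 := by gcongr
    nlinarith
  exact le_of_sq_le_sq hsq (by positivity)

/-- The off-diagonal bound before inserting the lower bound for `‖z - w‖`. -/
theorem norm_bergmanKernel_mul_norm_sub_le {Ω : TopologicalSpace.Opens ℂ}
    (hb : Bornology.IsBounded (Ω : Set ℂ)) (hsc : IsSimplyConnected (Ω : Set ℂ)) {z w : Ω}
    {δ ε : ℝ} (hδ : 0 < δ)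
    (hzδ : δ ≤ infDist (z : ℂ) (frontier (Ω : Set ℂ)))
    (hzε : infDist (z : ℂ) (frontier (Ω : Set ℂ)) ≤ ε)
    (hwδ : δ ≤ infDist (w : ℂ) (frontier (Ω : Set ℂ)))
    (hwε : infDist (w : ℂ) (frontier (Ω : Set ℂ)) ≤ ε) :
    ‖bergmanKernel Ω z w‖ * ‖(z : ℂ) - w‖ ≤ 16 * ε / (π * δ ^ 2) := by
  obtain ⟨F, hF, hsurj⟩ := exists_riemann_map Ω.isOpen hsc hb w.2
  have hz0 := hδ.trans_le hzδ
  have hw0 := hδ.trans_le hwδ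
  have hsep := one_sub_norm_mul_le hF hsurj hz0 hzε hw0 hwε
  have hFz1 : ‖F z‖ < 1 := mem_ball_zero_iff.1 (hF.mapsTo z.2)
  have hFw : ‖deriv F w‖ ≤ 1 / δ := by
    refine (hF.norm_deriv_le Ω.isOpen w.2 hw0).trans ?_
    rw [hF.map_base, norm_zero]
    gcongr
    norm_num
  have hpos : 0 ≤ 1 - ‖F z‖ ^ 2 := by nlinarith [norm_nonneg (F z)]
  have hFz : ‖deriv F z‖ ≤ (1 - ‖F z‖ ^ 2) / δ := by
    refine (hF.norm_deriv_le Ω.isOpen z.2 hz0).trans ?_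
    gcongr
  have hFz2 : (1 - ‖F z‖ ^ 2) * ‖(z : ℂ) - w‖ ≤ 16 * ε := by
    have h1 : (1 + ‖F z‖) * ((1 - ‖F z‖) * ‖(z : ℂ) - w‖) ≤ 2 * (8 * ε) := by
      exact mul_le_mul (by linarith) hsep (mul_nonneg (by linarith) (norm_nonneg _)) two_pos.le
    linarith
  rw [bergmanKernel_eq_of_riemann_map hF hsurj, norm_mul, norm_div, Complex.norm_conj,
    Complex.norm_real, Real.norm_of_nonneg Real.pi_pos.le]
  calc ‖deriv F w‖ / π * ‖deriv F z‖ * ‖(z : ℂ) - w‖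
      ≤ 1 / δ / π * ((1 - ‖F z‖ ^ 2) / δ) * ‖(z : ℂ) - w‖ := by gcongr
    _ = (1 - ‖F z‖ ^ 2) * ‖(z : ℂ) - w‖ / (π * δ ^ 2) := by field_simp
    _ ≤ _ := by gcongr

theorem propositionA1 :
    (∀ c : ℝ, 0 < c → ∃ M : ℝ, 0 < M ∧
      ∀ Ω : TopologicalSpace.Opens ℂ,
        Bornology.IsBounded (Ω : Set ℂ) → IsSimplyConnected (Ω : Set ℂ) →
      ∀ ε : ℝ, 0 < ε → ε ≤ 1 → ∀ z w : Ω,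
        c * ε ≤ Metric.infDist (z : ℂ) (frontier (Ω : Set ℂ)) →
        c * ε ≤ Metric.infDist (w : ℂ) (frontier (Ω : Set ℂ)) →
        ‖bergmanKernel Ω z w‖ ≤ M * ε ^ (-2 : ℝ)) ∧
    (∀ c : ℝ, 0 < c → ∃ M' : ℝ, 0 < M' ∧
      ∀ α : ℝ, 0 < α → α < 1 →
      ∀ Ω : TopologicalSpace.Opens ℂ,
        Bornology.IsBounded (Ω : Set ℂ) → IsSimplyConnected (Ω : Set ℂ) →
      ∀ ε : ℝ, 0 < ε → ε ≤ 1 → ∀ z w : Ω,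
        c * ε ≤ Metric.infDist (z : ℂ) (frontier (Ω : Set ℂ)) →
        Metric.infDist (z : ℂ) (frontier (Ω : Set ℂ)) ≤ ε →
        c * ε ≤ Metric.infDist (w : ℂ) (frontier (Ω : Set ℂ)) →
        Metric.infDist (w : ℂ) (frontier (Ω : Set ℂ)) ≤ ε →
        c * ε ^ α ≤ ‖(z : ℂ) - (w : ℂ)‖ →
        ‖bergmanKernel Ω z w‖ ≤ M' * ε ^ (-1 - α)) := by
  constructor
  · intro c hc
    refine ⟨4 / (π * c ^ 2), by positivity, fun Ω _ _ ε hε _ z w hz hw => ?_⟩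
    have hcε : 0 < c * ε := by positivity
    -- closed discs of half the distance to the boundary lie inside `Ω`
    have hsub : ∀ x : Ω, c * ε ≤ infDist (x : ℂ) (frontier (Ω : Set ℂ)) →
        closedBall (x : ℂ) (c * ε / 2) ⊆ Ω := fun x hx =>
      (closedBall_subset_ball (by linarith)).trans
        (ball_infDist_frontier_subset Ω.isOpen x.2)
    refine (norm_bergmanKernel_le (by positivity) (hsub z hz) (hsub w hw)).trans_eq ?_
    rw [Real.rpow_neg hε.le, Real.rpow_two]
    field_simp
    norm_num
  · intro c hc
    refine ⟨16 / (π * c ^ 3), by positivity,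
      fun α _ _ Ω hb hsc ε hε _ z w hzc hzε hwc hwε hzw => ?_⟩
    have h1 := norm_bergmanKernel_mul_norm_sub_le hb hsc (mul_pos hc hε) hzc hzε hwc hwε
    have hεα : 0 < ε ^ α := Real.rpow_pos_of_pos hε α
    have h2 : ‖bergmanKernel Ω z w‖ * (c * ε ^ α) ≤ 16 * ε / (π * (c * ε) ^ 2) :=
      (by gcongr : _ ≤ ‖bergmanKernel Ω z w‖ * ‖(z : ℂ) - w‖).trans h1
    rw [← le_div_iff₀ (by positivity)] at h2
    refine h2.trans_eq ?_
    rw [Real.rpow_sub hε, Real.rpow_neg_one]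
    field_simp
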